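/- Fix integers $k\ge 2$, $d\ge 1$ and a real $0<\theta<1$ with $d\theta>1$, and let $p\in(1,\infty)$ be determined by $d\theta=d^{1/p}$. Notation. Let $\omega^{\not\downarrow\le k}$ (resp. $\omega^{\not\downarrow k}$) be the set of non-decreasing sequences of natural numbers of length at most $k$ (resp. exactly $k$). It is ordered by $\prec$: the empty sequence is least, and $(s_1,\dots,s_i)\prec(t_1,\dots,t_j)$ iff $s_i<t_j$, or $s_i=t_j$ and $(s_1,\dots,s_i)$ is lexicographically below $(t_1,\dots,t_j)$ (a proper initial segment being below). An $\mathcal E_k$-tree is a map of $\omega^{\not\downarrow\le k}$ into itself preserving $\prec$ and the proper initial segment relation; $\mathcal{E}_k$ is the family of the images of $\omega^{\not\downarrow k}$ under such maps, and $\mathcal{AR}^k$ is the family of finite $\prec$-initial segments of members of $\mathcal E_k$. For $E,F\subset\omega^{\not\downarrow k}$ finite, $E<F$ means that every element of $E$ is $\prec$ every element of $F$; for vectors, $x<y$ means $\operatorname{supp}x<\operatorname{supp}y$, and $v\le x$, $x<v$ are understood likewise with $\{v\}$. For $x\in c_{00}(\omega^{\not\downarrow k})$ put $|x|_0=\max_v|x_v|$,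 $$|x|_{j+1}=\max\Bigl\{|x|_j,\ \theta\max\Bigl\{\sum_{i=1}^m|E_ix|_j:\ 1\le m\le d,\ \emptyset\ne E_i\in\mathcal{AR}^k,\ E_1<\dots<E_m\Bigr\}\Bigr\},$$ where $E_ix$ is the restriction of $x$ to $E_i$. Then $T_k(d,\theta)$ is the completion of $c_{00}(\omega^{\not\downarrow k})$ for the norm $\|x\|=\sup_j|x|_j$. A normalized block sequence is a (finite or infinite) sequence of finitely supported vectors of norm one with $x_1<x_2<\cdots$. For $v=(n_1,\dots,n_k)$ let $X_v^{\max}$ be the set of all $(f_1(m_1),\dots,f_k(m_k))$ with $(m_1,\dots,m_k)\in\omega^{\not\downarrow k}$, where $f_j(0)=n_j$ and $f_j(m)=n_k+m$ for $m\ge1$. Theorem. (1) For every finite normalized block sequence $(x_j)_{j=1}^N$ in $T_k(d,\theta)$ and all real $a_1,\dots,a_N$, $$\Bigl\|\sum_{j=1}^N a_jx_j\Bigr\|\le\frac2\theta\Bigl(\sum_{j=1}^N|a_j|^p\Bigr)^{1/p}.$$ (2) Let $(x_i)_{i\ge1}$ be a normalized block sequence in $T_k(d,\theta)$ for which there are $v_i\in\omega^{\not\downarrow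 k}$ with $v_1\le x_1<v_2\le x_2<v_3\le\cdots$ and, for every $i\ge1$, $\operatorname{supp}x_i\subset X_{v_i}^{\max}$ and $v_{i+1}\in X_{v_i}^{\max}$. Then, for all $n$ and all real $a_1,\dots,a_n$, $$\frac1{2d}\Bigl(\sum_{i=1}^n|a_i|^p\Bigr)^{1/p}\le\Bigl\|\sum_{i=1}^n a_ix_i\Bigr\|,$$ and $(x_i)$ is equivalent to the unit vector basis $(e_i)$ of $\ell_p$: for every real sequence $(a_i)$, $\sum_i a_ix_i$ converges in $T_k(d,\theta)$ if and only if $\sum_i a_ie_i$ converges in $\ell_p$. -/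

import Mathlib

open Filter Topology

noncomputable section

namespace EllentuckSpace

/-- Non-decreasing sequences of natural numbers of length at most `k`. -/
abbrev Omle (k : ℕ) : Type := {s : List ℕ // s.length ≤ k ∧ s.Pairwise (· ≤ ·)}

/-- Non-decreasing sequences of natural numbers of length exactly `k`. -/
abbrev Ome (k : ℕ) : Type := {s : List ℕ // s.length = k ∧ s.Pairwise (· ≤ ·)}

/-- The well-order `≺` on sequences: the empty sequence is the least element; nonempty
sequences are compared by their last entries first, and then lexicographically (where a proper
initial segment of a sequence is below that sequence). -/
def Prec (s t : List ℕ) : Prop :=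
  (s = [] ∧ t ≠ []) ∨
    (s ≠ [] ∧ t ≠ [] ∧
      (s.getLastD 0 < t.getLastD 0 ∨
        (s.getLastD 0 = t.getLastD 0 ∧ List.Lex (· < ·) s t)))

/-- The relation `≼`. -/
def PrecEq (s t : List ℕ) : Prop := Prec s t ∨ s = t

/-- `s ⊏ t`: `s` is a proper initial segment of `t`. -/
def ProperInit (s t : List ℕ) : Prop := s <+: t ∧ s.length < t.length

/-- An `𝓔_k`-tree: a self-map of `Omle k` preserving `≺` and `⊏`. -/
def IsEllentuckTree {k : ℕ} (X : Omle k → Omle k) : Prop :=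
  (∀ s t : Omle k, Prec s.1 t.1 → Prec (X s).1 (X t).1) ∧
    (∀ s t : Omle k, ProperInit s.1 t.1 → ProperInit (X s).1 (X t).1)

/-- The member of `𝓔_k` determined by a tree, identified with its range: the image of `Ome k`. -/
def body {k : ℕ} (X : Omle k → Omle k) : Set (Ome k) :=
  {w | ∃ u : Ome k, (X ⟨u.1, u.2.1.le, u.2.2⟩).1 = w.1}

/-- `𝒜ℛ^k`: the finite approximations to members of `𝓔_k`, that is, the finite `≺`-initial
segments of ranges of members of `𝓔_k`. -/
def IsApprox {k : ℕ} (E : Finset (Ome k)) : Prop :=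
  ∃ X : Omle k → Omle k, IsEllentuckTree X ∧ (∀ e ∈ E, e ∈ body X) ∧
    ∀ w ∈ body X, ∀ e ∈ E, Prec w.1 e.1 → w ∈ E

/-- `E < F` for finite sets: every element of `E` is `≺`-below every element of `F`. -/
def Successive {k : ℕ} (E F : Finset (Ome k)) : Prop :=
  ∀ e ∈ E, ∀ f ∈ F, Prec e.1 f.1

/-- Admissible sequences `E_1 < E_2 < ⋯ < E_m` of nonempty finite approximations. -/
def Admissible {k m : ℕ} (E : Fin m → Finset (Ome k)) : Prop :=
  (∀ i, (E i).Nonempty ∧ IsApprox (E i)) ∧ ∀ i j, i < j → Successive (E i) (E j)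

/-- The maximal member `X_v^max` of `𝓔_k` with first element `v = (n_1, …, n_k)`: the set of all
`(f_1(m_1), …, f_k(m_k))` with `(m_1, …, m_k) ∈ Ome k`, where `f_j(0) = n_j` and
`f_j(m) = n_k + m` for `m > 0`. -/
def Xmax {k : ℕ} (v : Ome k) : Set (Ome k) :=
  {w | ∃ t : Ome k,
    w.1 = List.zipWith (fun n m => if m = 0 then n else v.1.getLastD 0 + m) v.1 t.1}

/-- The coordinate restriction `E x`. -/
def restr {k : ℕ} (E : Finset (Ome k)) (x : Ome k →₀ ℝ) : Ome k →₀ ℝ :=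
  x.filter (· ∈ E)

/-- The values `∑ |E_i x|` over admissible sequences of length `1 ≤ m ≤ d`, where `|·|` is a given
function `N`. -/
def admSums {k : ℕ} (d : ℕ) (N : (Ome k →₀ ℝ) → ℝ) (x : Ome k →₀ ℝ) : Set ℝ :=
  {r | ∃ m : ℕ, 1 ≤ m ∧ m ≤ d ∧ ∃ E : Fin m → Finset (Ome k), Admissible E ∧
    r = ∑ i, N (restr (E i) x)}

/-- The non-decreasing sequence of norms `|·|_j` on finitely supported vectors. -/
def normSeq {k : ℕ} (d : ℕ) (θ : ℝ) : ℕ → (Ome k →₀ ℝ) → ℝ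
  | 0, x => ⨆ v, |x v|
  | j + 1, x => max (normSeq d θ j x) (θ * sSup (admSums d (normSeq d θ j) x))

/-- The norm `sup_j |x|_j` on finitely supported vectors. -/
def tNorm {k : ℕ} (d : ℕ) (θ : ℝ) (x : Ome k →₀ ℝ) : ℝ := ⨆ j, normSeq d θ j x

/-- The `ℓ_1` norm; only used to show that the suprema above are finite. -/
def l1 {k : ℕ} (x : Ome k →₀ ℝ) : ℝ := ∑ v ∈ x.support, |x v|

theorem prec_irrefl (s : List ℕ) : ¬ Prec s s := by
  rintro (⟨h, h'⟩ | ⟨_, _, h | ⟨_, h⟩⟩)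
  · exact h' h
  · exact lt_irrefl _ h
  · exact lt_irrefl s h

theorem Admissible.disjoint {k m : ℕ} {E : Fin m → Finset (Ome k)} (h : Admissible E)
    {i j : Fin m} (hij : i ≠ j) : Disjoint (E i) (E j) := by
  rw [Finset.disjoint_left]
  intro a hi hj
  rcases lt_or_gt_of_ne hij with hl | hl
  · exact prec_irrefl _ (h.2 i j hl a hi a hj)
  · exact prec_irrefl _ (h.2 j i hl a hj a hi)

theorem l1_restr {k : ℕ} (E : Finset (Ome k)) (x : Ome k →₀ ℝ) :
    l1 (restr E x) = ∑ v ∈ x.support.filter (· ∈ E), |x v| := by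
  unfold l1 restr
  rw [Finsupp.support_filter]
  refine Finset.sum_congr rfl fun v hv => ?_
  rw [Finsupp.filter_apply_pos _ _ (Finset.mem_filter.1 hv).2]

theorem sum_l1_restr_le {k m : ℕ} {E : Fin m → Finset (Ome k)} (h : Admissible E)
    (x : Ome k →₀ ℝ) : ∑ i, l1 (restr (E i) x) ≤ l1 x := by
  simp only [l1_restr]
  rw [← Finset.sum_biUnion]
  · refine Finset.sum_le_sum_of_subset_of_nonneg ?_ fun _ _ _ => abs_nonneg _
    intro v hv
    obtain ⟨i, _, hi⟩ := Finset.mem_biUnion.1 hv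
    exact (Finset.mem_filter.1 hi).1
  · intro i _ j _ hij
    refine Finset.disjoint_left.2 fun a ha hb => ?_
    exact Finset.disjoint_left.1 (h.disjoint hij) (Finset.mem_filter.1 ha).2
      (Finset.mem_filter.1 hb).2

theorem bddAbove_sup {k : ℕ} (x : Ome k →₀ ℝ) : BddAbove (Set.range fun v => |x v|) := by
  refine ⟨l1 x, ?_⟩
  rintro _ ⟨v, rfl⟩
  by_cases hv : v ∈ x.support
  · exact Finset.single_le_sum (f := fun v => |x v|) (fun _ _ => abs_nonneg _) hv
  · simp only [Finsupp.mem_support_iff, not_not] at hv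
    simp only [hv, abs_zero]
    exact Finset.sum_nonneg fun _ _ => abs_nonneg _

theorem l1_nonneg {k : ℕ} (x : Ome k →₀ ℝ) : 0 ≤ l1 x :=
  Finset.sum_nonneg fun _ _ => abs_nonneg _

section bounds

variable {k : ℕ} (d : ℕ) (θ : Set.Ioo (0 : ℝ) 1)

theorem normSeq_nonneg (j : ℕ) (x : Ome k →₀ ℝ) : 0 ≤ normSeq d θ j x := by
  induction j with
  | zero => exact Real.iSup_nonneg fun _ => abs_nonneg _
  | succ j ih => exact le_max_of_le_left ih

theorem admSums_le {N : (Ome k →₀ ℝ) → ℝ} (hN : ∀ y, N y ≤ l1 y) (x : Ome k →₀ ℝ) :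
    ∀ r ∈ admSums d N x, r ≤ l1 x := by
  rintro _ ⟨m, _, _, E, hE, rfl⟩
  exact (Finset.sum_le_sum fun i _ => hN _).trans (sum_l1_restr_le hE x)

theorem normSeq_le_l1 (j : ℕ) (x : Ome k →₀ ℝ) : normSeq d θ j x ≤ l1 x := by
  induction j generalizing x with
  | zero =>
    refine Real.iSup_le (fun v => ?_) (l1_nonneg x)
    by_cases hv : v ∈ x.support
    · exact Finset.single_le_sum (f := fun v => |x v|) (fun _ _ => abs_nonneg _) hv
    · simp only [Finsupp.mem_support_iff, not_not] at hv
      simp only [hv, abs_zero]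
      exact l1_nonneg x
  | succ j ih =>
    refine max_le (ih x) ?_
    have h1 : sSup (admSums d (normSeq d θ j) x) ≤ l1 x :=
      Real.sSup_le (admSums_le d ih x) (l1_nonneg x)
    have h2 := θ.2.1
    have h3 := θ.2.2
    nlinarith [l1_nonneg x]

theorem bddAbove_admSums (j : ℕ) (x : Ome k →₀ ℝ) :
    BddAbove (admSums d (normSeq d θ j) x) :=
  ⟨l1 x, admSums_le d (normSeq_le_l1 d θ j) x⟩

theorem bddAbove_normSeq (x : Ome k →₀ ℝ) :
    BddAbove (Set.range fun j => normSeq d (θ : ℝ) j x) := by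
  refine ⟨l1 x, ?_⟩
  rintro _ ⟨j, rfl⟩
  exact normSeq_le_l1 d θ j x

theorem admSums_nonneg (j : ℕ) (x : Ome k →₀ ℝ) :
    0 ≤ sSup (admSums d (normSeq d θ j) x) := by
  refine Real.sSup_nonneg ?_
  rintro _ ⟨m, _, _, E, _, rfl⟩
  exact Finset.sum_nonneg fun i _ => normSeq_nonneg d θ j _

theorem restr_add (E : Finset (Ome k)) (x y : Ome k →₀ ℝ) :
    restr E (x + y) = restr E x + restr E y := Finsupp.filter_add

theorem restr_smul (E : Finset (Ome k)) (c : ℝ) (x : Ome k →₀ ℝ) :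
    restr E (c • x) = c • restr E x := Finsupp.filter_smul

theorem normSeq_add (j : ℕ) (x y : Ome k →₀ ℝ) :
    normSeq d θ j (x + y) ≤ normSeq d θ j x + normSeq d θ j y := by
  induction j generalizing x y with
  | zero =>
    refine Real.iSup_le (fun v => ?_) (add_nonneg (normSeq_nonneg d θ 0 x) (normSeq_nonneg d θ 0 y))
    exact (abs_add_le _ _).trans
      (add_le_add (le_ciSup (bddAbove_sup x) v) (le_ciSup (bddAbove_sup y) v))
  | succ j ih =>
    refine max_le ((ih x y).trans (add_le_add (le_max_left _ _) (le_max_left _ _))) ?_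
    have h : sSup (admSums d (normSeq d θ j) (x + y)) ≤
        sSup (admSums d (normSeq d θ j) x) + sSup (admSums d (normSeq d θ j) y) := by
      refine Real.sSup_le ?_ (add_nonneg (admSums_nonneg d θ j x) (admSums_nonneg d θ j y))
      rintro _ ⟨m, h1, hm, E, hE, rfl⟩
      calc ∑ i, normSeq d θ j (restr (E i) (x + y))
          ≤ ∑ i, (normSeq d θ j (restr (E i) x) + normSeq d θ j (restr (E i) y)) :=
            Finset.sum_le_sum fun i _ => by rw [restr_add]; exact ih _ _
        _ = _ := Finset.sum_add_distrib
        _ ≤ _ := add_le_add (le_csSup (bddAbove_admSums d θ j x) ⟨m, h1, hm, E, hE, rfl⟩)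
            (le_csSup (bddAbove_admSums d θ j y) ⟨m, h1, hm, E, hE, rfl⟩)
    calc (θ : ℝ) * sSup (admSums d (normSeq d θ j) (x + y))
        ≤ θ * (sSup (admSums d (normSeq d θ j) x) + sSup (admSums d (normSeq d θ j) y)) :=
          mul_le_mul_of_nonneg_left h θ.2.1.le
      _ = _ := mul_add _ _ _
      _ ≤ _ := add_le_add (le_max_right _ _) (le_max_right _ _)

theorem normSeq_smul_le (c : ℝ) (j : ℕ) (x : Ome k →₀ ℝ) :
    normSeq d θ j (c • x) ≤ |c| * normSeq d θ j x := by
  induction j generalizing x with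
  | zero =>
    refine Real.iSup_le (fun v => ?_) (mul_nonneg (abs_nonneg c) (normSeq_nonneg d θ 0 x))
    rw [Finsupp.smul_apply, smul_eq_mul, abs_mul]
    exact mul_le_mul_of_nonneg_left (le_ciSup (bddAbove_sup x) v) (abs_nonneg c)
  | succ j ih =>
    refine max_le ((ih x).trans (mul_le_mul_of_nonneg_left (le_max_left _ _) (abs_nonneg c))) ?_
    have h : sSup (admSums d (normSeq d θ j) (c • x)) ≤
        |c| * sSup (admSums d (normSeq d θ j) x) := by
      refine Real.sSup_le ?_ (mul_nonneg (abs_nonneg c) (admSums_nonneg d θ j x))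
      rintro _ ⟨m, h1, hm, E, hE, rfl⟩
      calc ∑ i, normSeq d θ j (restr (E i) (c • x))
          ≤ ∑ i, |c| * normSeq d θ j (restr (E i) x) :=
            Finset.sum_le_sum fun i _ => by rw [restr_smul]; exact ih _
        _ = |c| * ∑ i, normSeq d θ j (restr (E i) x) := by rw [Finset.mul_sum]
        _ ≤ _ := mul_le_mul_of_nonneg_left
            (le_csSup (bddAbove_admSums d θ j x) ⟨m, h1, hm, E, hE, rfl⟩) (abs_nonneg c)
    calc (θ : ℝ) * sSup (admSums d (normSeq d θ j) (c • x))
        ≤ θ * (|c| * sSup (admSums d (normSeq d θ j) x)) :=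
          mul_le_mul_of_nonneg_left h θ.2.1.le
      _ = |c| * (θ * sSup (admSums d (normSeq d θ j) x)) := by ring
      _ ≤ _ := mul_le_mul_of_nonneg_left (le_max_right _ _) (abs_nonneg c)

theorem tNorm_nonneg (x : Ome k →₀ ℝ) : 0 ≤ tNorm d θ x :=
  Real.iSup_nonneg fun j => normSeq_nonneg d θ j x

theorem tNorm_add (x y : Ome k →₀ ℝ) :
    tNorm d θ (x + y) ≤ tNorm d θ x + tNorm d θ y :=
  Real.iSup_le (fun j => (normSeq_add d θ j x y).trans
    (add_le_add (le_ciSup (bddAbove_normSeq d θ x) j) (le_ciSup (bddAbove_normSeq d θ y) j)))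
    (add_nonneg (tNorm_nonneg d θ x) (tNorm_nonneg d θ y))

theorem tNorm_smul_le (c : ℝ) (x : Ome k →₀ ℝ) :
    tNorm d θ (c • x) ≤ |c| * tNorm d θ x :=
  Real.iSup_le (fun j => (normSeq_smul_le d θ c j x).trans
    (mul_le_mul_of_nonneg_left (le_ciSup (bddAbove_normSeq d θ x) j) (abs_nonneg c)))
    (mul_nonneg (abs_nonneg c) (tNorm_nonneg d θ x))

theorem tNorm_smul (c : ℝ) (x : Ome k →₀ ℝ) :
    tNorm d θ (c • x) = |c| * tNorm d θ x := by
  refine le_antisymm (tNorm_smul_le d θ c x) ?_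
  rcases eq_or_ne c 0 with rfl | hc
  · rw [abs_zero, zero_mul]
    exact tNorm_nonneg d θ _
  · have h := tNorm_smul_le d θ c⁻¹ (c • x)
    rw [smul_smul, inv_mul_cancel₀ hc, one_smul, abs_inv] at h
    have hc' : 0 < |c| := abs_pos.2 hc
    calc |c| * tNorm d θ x ≤ |c| * (|c|⁻¹ * tNorm d θ (c • x)) :=
          mul_le_mul_of_nonneg_left h hc'.le
      _ = tNorm d θ (c • x) := by rw [← mul_assoc, mul_inv_cancel₀ hc'.ne', one_mul]

theorem tNorm_eq_zero {x : Ome k →₀ ℝ} : tNorm d θ x = 0 ↔ x = 0 := by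
  constructor
  · intro h
    ext v
    have h1 : |x v| ≤ normSeq d θ 0 x := le_ciSup (bddAbove_sup x) v
    have h2 : normSeq d θ 0 x ≤ tNorm d θ x := le_ciSup (bddAbove_normSeq d θ x) 0
    exact abs_eq_zero.1 (le_antisymm (by linarith) (abs_nonneg _))
  · rintro rfl
    have h := tNorm_smul d θ 0 (0 : Ome k →₀ ℝ)
    rwa [zero_smul, abs_zero, zero_mul] at h

end bounds

/-- The space `c_00(Ome k)` carrying the norm of `T_k(d, θ)`. -/
def PreT (k _d : ℕ) (_θ : Set.Ioo (0 : ℝ) 1) : Type := Ome k →₀ ℝ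

instance (k d : ℕ) (θ : Set.Ioo (0 : ℝ) 1) : AddCommGroup (PreT k d θ) :=
  inferInstanceAs (AddCommGroup (Ome k →₀ ℝ))

instance (k d : ℕ) (θ : Set.Ioo (0 : ℝ) 1) : Module ℝ (PreT k d θ) :=
  inferInstanceAs (Module ℝ (Ome k →₀ ℝ))

instance (k d : ℕ) (θ : Set.Ioo (0 : ℝ) 1) : Norm (PreT k d θ) :=
  ⟨fun x => tNorm d (θ : ℝ) (show Ome k →₀ ℝ from x)⟩

theorem preT_core (k d : ℕ) (θ : Set.Ioo (0 : ℝ) 1) : NormedSpace.Core ℝ (PreT k d θ) where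
  norm_nonneg x := tNorm_nonneg d θ (show Ome k →₀ ℝ from x)
  norm_smul c x := tNorm_smul d θ c (show Ome k →₀ ℝ from x)
  norm_triangle x y := tNorm_add d θ (show Ome k →₀ ℝ from x) (show Ome k →₀ ℝ from y)
  norm_eq_zero_iff _ := tNorm_eq_zero d θ

instance (k d : ℕ) (θ : Set.Ioo (0 : ℝ) 1) : NormedAddCommGroup (PreT k d θ) :=
  NormedAddCommGroup.ofCore (preT_core k d θ)

instance (k d : ℕ) (θ : Set.Ioo (0 : ℝ) 1) : NormedSpace ℝ (PreT k d θ) :=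
  NormedSpace.ofCore (preT_core k d θ)

/-- The Banach space `T_k(d, θ)`: the completion of `c_00(Ome k)`. -/
abbrev TSpace (k d : ℕ) (θ : Set.Ioo (0 : ℝ) 1) : Type :=
  UniformSpace.Completion (PreT k d θ)

/-- The canonical inclusion of the finitely supported vectors into `T_k(d, θ)`. -/
def incl {k : ℕ} (d : ℕ) (θ : Set.Ioo (0 : ℝ) 1) (x : Ome k →₀ ℝ) : TSpace k d θ :=
  ((show PreT k d θ from x) : UniformSpace.Completion (PreT k d θ))

theorem norm_incl {k : ℕ} (d : ℕ) (θ : Set.Ioo (0 : ℝ) 1) (x : Ome k →₀ ℝ) :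
    ‖incl d θ x‖ = tNorm d (θ : ℝ) x :=
  UniformSpace.Completion.norm_coe (E := PreT k d θ) x

/-- A normalized block sequence in `T_k(d, θ)`, finite or infinite: finitely supported vectors
of norm one with successive supports. -/
def IsNormalizedBlock {k : ℕ} (d : ℕ) (θ : Set.Ioo (0 : ℝ) 1) {ι : Type} [LT ι]
    (x : ι → Ome k →₀ ℝ) : Prop :=
  (∀ i, ‖incl d θ (x i)‖ = 1) ∧ ∀ i j, i < j → Successive (x i).support (x j).support

/-- Two sequences in normed spaces are equivalent if, for all scalars `a_i`, the series
`∑ a_i x_i` converges if and only if `∑ a_i y_i` converges. -/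
def EquivalentSeq {E F : Type} [NormedAddCommGroup E] [NormedSpace ℝ E]
    [NormedAddCommGroup F] [NormedSpace ℝ F] (x : ℕ → E) (y : ℕ → F) : Prop :=
  ∀ a : ℕ → ℝ,
    (∃ l : E, Tendsto (fun n => ∑ i ∈ Finset.range n, a i • x i) atTop (𝓝 l)) ↔
      (∃ l : F, Tendsto (fun n => ∑ i ∈ Finset.range n, a i • y i) atTop (𝓝 l))

end EllentuckSpace

end

open EllentuckSpace

namespace EllentuckSpace

/-! The exponent enters through one identity: $d\theta=d^{1/p}$ says $\theta=d^{-(1-1/p)}$, so the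
Hölder loss for a sum of at most $d$ terms is exactly $1/\theta$.

Upper estimate (`normSeq_sum_le_weights`). Induct on the level $j$ of the norm. Given
$E_1<\dots<E_m$, call a block rich if some $E_l$ meets it and no other block. The whole norm of a
rich block is charged to one such $E_l$, since $\theta\sum_l|E_ly_i|_j\le\|y_i\|$. A block that is
not rich meets at most two sets: one strictly between its first and its last would meet it alone.
Its two pieces are paid for by separate weights, $b$ for the first set and $c$ for the last. The two
weights give the 2 of the constant. The rich blocks have used up the factor $\theta$, so summing
over $l$ costs $1/\theta$, and the constant $1/\theta$ reproduces itself.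

Lower estimate. The part of $X_{v_s}^{\max}$ below $v_t$ lies in $\mathcal{AR}^k$ and cuts out
exactly the blocks $s\le i<t$. So the norms $F(s,t)$ of the partial sums over $[s,t)$ are monotone
and satisfy $\theta\sum_{l<d}F(s_l,s_{l+1})\le F(s_0,s_d)$ (`sum_blockNorm_le`). The rest concerns
$F$ alone (`lower_estimate`): lay intervals of lengths $|a_i|^p$ end to end and divide the total
length $A$ repeatedly into $d$ equal parts until each midpoint is isolated. If this takes $\sigma_i$
divisions, then $\sum_i\theta^{\sigma_i}|a_i|\le F(0,n)$, and $d^{-\sigma_i}\ge|a_i|^p/(2dA)$ turns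
the left side into a multiple of $A^{1/p}$. -/

/-! ### The order and coordinate restrictions -/

theorem Prec.trans {s t u : List ℕ} (h₁ : Prec s t) (h₂ : Prec t u) : Prec s u := by
  rcases h₁ with ⟨rfl, ht⟩ | ⟨hs, ht, h₁⟩
  · rcases h₂ with ⟨rfl, _⟩ | ⟨_, hu, _⟩
    · exact absurd rfl ht
    · exact Or.inl ⟨rfl, hu⟩
  · rcases h₂ with ⟨rfl, _⟩ | ⟨_, hu, h₂⟩
    · exact absurd rfl ht
    · refine Or.inr ⟨hs, hu, ?_⟩
      rcases h₁ with h₁ | ⟨h₁, l₁⟩ <;> rcases h₂ with h₂ | ⟨h₂, l₂⟩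
      · exact Or.inl (h₁.trans h₂)
      · exact Or.inl (h₂ ▸ h₁)
      · exact Or.inl (h₁ ▸ h₂)
      · exact Or.inr ⟨h₁.trans h₂, lt_trans (a := s) (b := t) (c := u) l₁ l₂⟩

theorem Prec.asymm {s t : List ℕ} (h₁ : Prec s t) (h₂ : Prec t s) : False :=
  prec_irrefl _ (h₁.trans h₂)

theorem restr_restr_comm {k : ℕ} (E F : Finset (Ome k)) (x : Ome k →₀ ℝ) :
    restr E (restr F x) = restr F (restr E x) := by
  classical
  ext v
  simp only [restr, Finsupp.filter_apply]
  split_ifs <;> rfl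

theorem restr_sum {k : ℕ} {ι : Type*} (E : Finset (Ome k)) (I : Finset ι)
    (y : ι → Ome k →₀ ℝ) : restr E (∑ i ∈ I, y i) = ∑ i ∈ I, restr E (y i) :=
  Finsupp.filter_sum I y

theorem mem_support_restr {k : ℕ} {E : Finset (Ome k)} {x : Ome k →₀ ℝ} {v : Ome k} :
    v ∈ (restr E x).support ↔ v ∈ x.support ∧ v ∈ E := by
  classical
  unfold restr
  rw [Finsupp.support_filter, Finset.mem_filter]

theorem restr_eq_self {k : ℕ} {E : Finset (Ome k)} {x : Ome k →₀ ℝ} (h : x.support ⊆ E) :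
    restr E x = x :=
  Finsupp.filter_eq_self_iff _ _ |>.2 fun _ hv => h (Finsupp.mem_support_iff.2 hv)

theorem restr_eq_zero {k : ℕ} {E : Finset (Ome k)} {x : Ome k →₀ ℝ}
    (h : ∀ v ∈ x.support, v ∉ E) : restr E x = 0 :=
  Finsupp.filter_eq_zero_iff _ _ |>.2 fun v hv => by
    by_contra hx
    exact h v (Finsupp.mem_support_iff.2 hx) hv

theorem exists_mem_of_restr_ne_zero {k : ℕ} {E : Finset (Ome k)} {x : Ome k →₀ ℝ}
    (h : restr E x ≠ 0) : ∃ v ∈ x.support, v ∈ E := by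
  by_contra! h'
  exact h (restr_eq_zero h')

/-! ### Restrictions and admissible sums under the norms -/

section

variable {k : ℕ} (d : ℕ) (θ : Set.Ioo (0 : ℝ) 1)

theorem normSeq_restr_le (j : ℕ) (F : Finset (Ome k)) (x : Ome k →₀ ℝ) :
    normSeq d θ j (restr F x) ≤ normSeq d θ j x := by
  classical
  induction j generalizing x with
  | zero =>
    refine Real.iSup_le (fun v => ?_) (normSeq_nonneg d θ 0 x)
    refine le_trans ?_ (le_ciSup (bddAbove_sup x) v)
    simp only [restr, Finsupp.filter_apply]
    split_ifs <;> simp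
  | succ j ih =>
    refine max_le ((ih x).trans (le_max_left _ _)) (le_trans ?_ (le_max_right _ _))
    refine mul_le_mul_of_nonneg_left (Real.sSup_le ?_ (admSums_nonneg d θ j x)) θ.2.1.le
    rintro _ ⟨m, h1, hm, E, hE, rfl⟩
    refine le_trans (Finset.sum_le_sum fun i _ => ?_)
      (le_csSup (bddAbove_admSums d θ j x) ⟨m, h1, hm, E, hE, rfl⟩)
    rw [restr_restr_comm]
    exact ih _

theorem normSeq_le_tNorm (j : ℕ) (x : Ome k →₀ ℝ) : normSeq d θ j x ≤ tNorm d θ x :=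
  le_ciSup (bddAbove_normSeq d θ x) j

theorem abs_apply_le_tNorm (x : Ome k →₀ ℝ) (v : Ome k) : |x v| ≤ tNorm d θ x :=
  (le_ciSup (bddAbove_sup x) v).trans (normSeq_le_tNorm d θ 0 x)

theorem tNorm_restr_le (F : Finset (Ome k)) (x : Ome k →₀ ℝ) :
    tNorm d θ (restr F x) ≤ tNorm d θ x :=
  Real.iSup_le (fun j => (normSeq_restr_le d θ j F x).trans (normSeq_le_tNorm d θ j x))
    (tNorm_nonneg d θ x)

theorem normSeq_zero (j : ℕ) : normSeq d θ j (0 : Ome k →₀ ℝ) = 0 := by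
  have h := normSeq_smul_le d θ 0 j (0 : Ome k →₀ ℝ)
  rw [zero_smul, abs_zero, zero_mul] at h
  exact le_antisymm h (normSeq_nonneg d θ j _)

theorem normSeq_sum_le {ι : Type*} (j : ℕ) (I : Finset ι) (y : ι → Ome k →₀ ℝ) :
    normSeq d θ j (∑ i ∈ I, y i) ≤ ∑ i ∈ I, normSeq d θ j (y i) :=
  Finset.le_sum_of_subadditive _ (normSeq_zero d θ j).le (normSeq_add d θ j) _ _

theorem sum_normSeq_restr_le {m : ℕ} (h1 : 1 ≤ m) (hm : m ≤ d) {E : Fin m → Finset (Ome k)}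
    (hE : Admissible E) (j : ℕ) (x : Ome k →₀ ℝ) :
    θ * ∑ l, normSeq d θ j (restr (E l) x) ≤ tNorm d θ x :=
  le_trans (le_trans (mul_le_mul_of_nonneg_left
    (le_csSup (bddAbove_admSums d θ j x) ⟨m, h1, hm, E, hE, rfl⟩) θ.2.1.le) (le_max_right _ _))
    (normSeq_le_tNorm d θ (j + 1) x)

theorem tendsto_normSeq (x : Ome k →₀ ℝ) :
    Tendsto (fun j => normSeq d θ j x) atTop (𝓝 (tNorm d θ x)) :=
  tendsto_atTop_ciSup (monotone_nat_of_le_succ fun _ => le_max_left _ _) (bddAbove_normSeq d θ x)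

/-- Level $j$ on the left is paid for by level $j+1$ on the right; since the sum is finite,
$j\to\infty$ is allowed. -/
theorem sum_tNorm_restr_le {m : ℕ} (h1 : 1 ≤ m) (hm : m ≤ d) {E : Fin m → Finset (Ome k)}
    (hE : Admissible E) (x : Ome k →₀ ℝ) :
    θ * ∑ l, tNorm d θ (restr (E l) x) ≤ tNorm d θ x :=
  le_of_tendsto' (Tendsto.const_mul _ (tendsto_finsetSum _ fun _ _ => tendsto_normSeq d θ _))
    fun j => sum_normSeq_restr_le d θ h1 hm hE j x

/-! ### The upper $\ell_p$ estimate -/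

variable {d} {θ} {p : ℝ}

/-- Hölder with at most $d$ terms costs $d^{1-1/p}=1/\theta$. In the upper estimate, this is where
the choice of $p$ matters. -/
theorem mul_sum_rpow_le (hp : 1 < p) (hdp : (d : ℝ) * (θ : ℝ) = (d : ℝ) ^ (1 / p)) (hd : 0 < d)
    {m : ℕ} (hm : m ≤ d) (s : Fin m → ℝ) (hs : ∀ l, 0 ≤ s l) :
    θ * ∑ l, s l ^ (1 / p) ≤ (∑ l, s l) ^ (1 / p) := by
  have hp0 : 0 < p := by linarith
  have hd' : (0 : ℝ) < d := by exact_mod_cast hd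
  have hS : 0 ≤ ∑ l, s l := Finset.sum_nonneg fun l _ => hs l
  have h1 := Real.rpow_sum_le_const_mul_sum_rpow_of_nonneg Finset.univ
    (f := fun l => s l ^ (1 / p)) hp.le (fun l _ => Real.rpow_nonneg (hs l) _)
  have h2 : ∀ l, (s l ^ (1 / p)) ^ p = s l := fun l => by
    rw [← Real.rpow_mul (hs l), one_div_mul_cancel hp0.ne', Real.rpow_one]
  simp only [h2, Finset.card_univ, Fintype.card_fin] at h1
  have h3 : (∑ l, s l ^ (1 / p)) ^ p ≤ (d : ℝ) ^ (p - 1) * ∑ l, s l :=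
    h1.trans (mul_le_mul_of_nonneg_right
      (Real.rpow_le_rpow (by positivity) (by exact_mod_cast hm) (by linarith)) hS)
  have hT : 0 ≤ ∑ l, s l ^ (1 / p) := Finset.sum_nonneg fun l _ => Real.rpow_nonneg (hs l) _
  have h4 := Real.rpow_le_rpow (Real.rpow_nonneg hT _) h3 (one_div_nonneg.2 hp0.le)
  rw [← Real.rpow_mul hT, mul_one_div_cancel hp0.ne', Real.rpow_one,
    Real.mul_rpow (by positivity) hS, ← Real.rpow_mul hd'.le] at h4
  have h5 : (θ : ℝ) * (d : ℝ) ^ ((p - 1) * (1 / p)) = 1 := by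
    have h6 : (p - 1) * (1 / p) = 1 - 1 / p := by field_simp
    rw [h6, Real.rpow_sub hd', Real.rpow_one, ← hdp]
    have := θ.2.1
    field_simp
  calc θ * ∑ l, s l ^ (1 / p)
      ≤ θ * ((d : ℝ) ^ ((p - 1) * (1 / p)) * (∑ l, s l) ^ (1 / p)) :=
        mul_le_mul_of_nonneg_left h4 θ.2.1.le
    _ = _ := by rw [← mul_assoc, h5, one_mul]

theorem mul_sum_fiber_rpow_le (hp : 1 < p) (hdp : (d : ℝ) * (θ : ℝ) = (d : ℝ) ^ (1 / p))
    (hd : 0 < d) {m : ℕ} (hm : m ≤ d) (I : Finset ℕ) (α : ℕ → Fin m) (b : ℕ → ℝ)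
    (hb : ∀ i, 0 ≤ b i) :
    θ * ∑ l, (∑ i ∈ I, (if α i = l then b i else 0) ^ p) ^ (1 / p) ≤
      (∑ i ∈ I, b i ^ p) ^ (1 / p) := by
  refine (mul_sum_rpow_le hp hdp hd hm _ fun l => Finset.sum_nonneg fun i _ => ?_).trans_eq ?_
  · split_ifs
    · exact Real.rpow_nonneg (hb i) _
    · exact Real.rpow_nonneg le_rfl _
  · rw [Finset.sum_comm]
    congr 1
    refine Finset.sum_congr rfl fun i _ => ?_
    have : ∀ l, (if α i = l then b i else 0) ^ p = if α i = l then b i ^ p else 0 := fun l => by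
      split_ifs
      · rfl
      · exact Real.zero_rpow (by linarith)
    simp [this]

theorem le_rpow_sum (hp : 0 < p) {I : Finset ℕ} {b : ℕ → ℝ} (hb : ∀ i, 0 ≤ b i) {i : ℕ}
    (hi : i ∈ I) : b i ≤ (∑ i ∈ I, b i ^ p) ^ (1 / p) := by
  have h := Real.rpow_le_rpow (Real.rpow_nonneg (hb i) _)
    (Finset.single_le_sum (f := fun i => b i ^ p) (fun i _ => Real.rpow_nonneg (hb i) p) hi)
    (one_div_nonneg.2 hp.le)
  rwa [← Real.rpow_mul (hb i), mul_one_div_cancel hp.ne', Real.rpow_one] at h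

/-- Upper `ℓ_p` estimate with two weights: only the first block may be missing from `b`,
only the last one from `c`. -/
theorem normSeq_sum_le_weights (hp : 1 < p) (hdp : (d : ℝ) * (θ : ℝ) = (d : ℝ) ^ (1 / p))
    (hd : 0 < d) (j : ℕ) (I : Finset ℕ) (y : ℕ → Ome k →₀ ℝ)
    (hy : ∀ i ∈ I, ∀ i' ∈ I, i < i' → Successive (y i).support (y i').support)
    (b c : ℕ → ℝ) (hb : ∀ i, 0 ≤ b i) (hc : ∀ i, 0 ≤ c i)
    (h₁ : ∀ i ∈ I, ∀ i' ∈ I, i' < i → tNorm d θ (y i) ≤ b i)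
    (h₂ : ∀ i ∈ I, ∀ i' ∈ I, i < i' → tNorm d θ (y i) ≤ c i)
    (h₃ : ∀ i ∈ I, tNorm d θ (y i) ≤ b i + c i) :
    normSeq d θ j (∑ i ∈ I, y i) ≤
      1 / θ * ((∑ i ∈ I, b i ^ p) ^ (1 / p) + (∑ i ∈ I, c i ^ p) ^ (1 / p)) := by
  classical
  have hp0 : 0 < p := by linarith
  have hθ : (0 : ℝ) < θ := θ.2.1
  have hθ1 : 1 ≤ 1 / (θ : ℝ) := by rw [le_div_iff₀ hθ]; linarith [θ.2.2]
  induction j generalizing I y b c with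
  | zero =>
    have hnn : 0 ≤ (∑ i ∈ I, b i ^ p) ^ (1 / p) + (∑ i ∈ I, c i ^ p) ^ (1 / p) :=
      add_nonneg
        (Real.rpow_nonneg (Finset.sum_nonneg fun i _ => Real.rpow_nonneg (hb i) _) _)
        (Real.rpow_nonneg (Finset.sum_nonneg fun i _ => Real.rpow_nonneg (hc i) _) _)
    refine Real.iSup_le (fun v => ?_) (by positivity)
    by_cases hv : ∃ i ∈ I, y i v ≠ 0
    -- The supports are disjoint, so a single block lives at $v$.
    · obtain ⟨i, hi, hiv⟩ := hv
      have h : (∑ i ∈ I, y i) v = y i v := by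
        rw [Finsupp.finsetSum_apply]
        refine Finset.sum_eq_single_of_mem i hi fun i' hi' hne => ?_
        by_contra h0
        rcases lt_or_gt_of_ne hne with hl | hl
        · exact prec_irrefl _ (hy i' hi' i hi hl v (Finsupp.mem_support_iff.2 h0) v
            (Finsupp.mem_support_iff.2 hiv))
        · exact prec_irrefl _ (hy i hi i' hi' hl v (Finsupp.mem_support_iff.2 hiv) v
            (Finsupp.mem_support_iff.2 h0))
      rw [h]
      calc |y i v| ≤ b i + c i := (abs_apply_le_tNorm d θ _ v).trans (h₃ i hi)
        _ ≤ 1 * ((∑ i ∈ I, b i ^ p) ^ (1 / p) + (∑ i ∈ I, c i ^ p) ^ (1 / p)) := by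
          rw [one_mul]; exact add_le_add (le_rpow_sum hp0 hb hi) (le_rpow_sum hp0 hc hi)
        _ ≤ _ := mul_le_mul_of_nonneg_right hθ1 hnn
    · push Not at hv
      rw [Finsupp.finsetSum_apply, Finset.sum_eq_zero hv, abs_zero]
      positivity
  | succ j ih =>
    refine max_le (ih I y hy b c hb hc h₁ h₂ h₃) ?_
    have hnn : 0 ≤ (∑ i ∈ I, b i ^ p) ^ (1 / p) + (∑ i ∈ I, c i ^ p) ^ (1 / p) :=
      add_nonneg
        (Real.rpow_nonneg (Finset.sum_nonneg fun i _ => Real.rpow_nonneg (hb i) _) _)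
        (Real.rpow_nonneg (Finset.sum_nonneg fun i _ => Real.rpow_nonneg (hc i) _) _)
    rw [← le_div_iff₀' hθ]
    refine Real.sSup_le ?_ (by positivity)
    rintro _ ⟨m, hm1, hmd, E, hE, rfl⟩
    rw [le_div_iff₀' hθ]
    -- Order is respected on both sides: a later set cannot meet an earlier block while an earlier
    -- set meets a later block.
    have cross : ∀ i ∈ I, ∀ i' ∈ I, ∀ l l' : Fin m, i < i' → l < l' →
        restr (E l') (y i) ≠ 0 → restr (E l) (y i') ≠ 0 → False := by
      intro i hi i' hi' l l' hii hll h h'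
      obtain ⟨e, he, heE⟩ := exists_mem_of_restr_ne_zero h
      obtain ⟨f, hf, hfE⟩ := exists_mem_of_restr_ne_zero h'
      exact (hy i hi i' hi' hii e he f hf).asymm (hE.2 l l' hll f hfE e heE)
    -- The set $E_l$ meets $y_i$ and no other block; a block is rich if this happens for some $l$.
    set R : ℕ → Fin m → Prop := fun i l =>
      restr (E l) (y i) ≠ 0 ∧ ∀ i' ∈ I, restr (E l) (y i') ≠ 0 → i' = i with hR
    -- A rich block gets one index twice, a set that meets it alone. Any other block gets the first
    -- and the last index that meet it; the index 0 is a dummy for blocks that meet no set.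
    have hex : ∀ i, ∃ αβ : Fin m × Fin m, ((∃ l, R i l) → R i αβ.1 ∧ αβ.2 = αβ.1) ∧
        ((¬ ∃ l, R i l) → ∀ l, restr (E l) (y i) ≠ 0 → αβ.1 ≤ l ∧ l ≤ αβ.2 ∧
          restr (E αβ.1) (y i) ≠ 0 ∧ restr (E αβ.2) (y i) ≠ 0) := by
      intro i
      by_cases h : ∃ l, R i l
      · obtain ⟨l, hl⟩ := h
        exact ⟨(l, l), fun _ => ⟨hl, rfl⟩, fun h => absurd ⟨l, hl⟩ h⟩
      · by_cases h' : ∃ l, restr (E l) (y i) ≠ 0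
        · have hne : (Finset.univ.filter fun l => restr (E l) (y i) ≠ 0).Nonempty := by
            obtain ⟨l, hl⟩ := h'
            exact ⟨l, by simpa using hl⟩
          refine ⟨(Finset.min' _ hne, Finset.max' _ hne), fun h0 => absurd h0 h,
            fun _ l hl => ⟨Finset.min'_le _ _ (by simpa using hl),
              Finset.le_max' _ _ (by simpa using hl), ?_, ?_⟩⟩
          · exact (Finset.mem_filter.1 (Finset.min'_mem _ hne)).2
          · exact (Finset.mem_filter.1 (Finset.max'_mem _ hne)).2
        · exact ⟨(⟨0, hm1⟩, ⟨0, hm1⟩), fun h0 => absurd h0 h, fun _ l hl => absurd ⟨l, hl⟩ h'⟩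
    choose αβ hαβ1 hαβ2 using hex
    set α : ℕ → Fin m := fun i => (αβ i).1 with hα
    set β : ℕ → Fin m := fun i => (αβ i).2 with hβ
    set Ir := I.filter fun i => ∃ l, R i l with hIr
    set In := I.filter fun i => ¬ ∃ l, R i l with hIn
    -- The account of a single set: the weight $b_i$ is spent at $\alpha(i)$ only and $c_i$ at
    -- $\beta(i)$ only. The rich term carries no factor $\theta$.
    have step : ∀ l, θ * normSeq d θ j (∑ i ∈ In, restr (E l) (y i)) +
        ∑ i ∈ Ir.filter (α · = l), tNorm d θ (y i) ≤
        (∑ i ∈ I, (if α i = l then b i else 0) ^ p) ^ (1 / p) +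
          (∑ i ∈ I, (if β i = l then c i else 0) ^ p) ^ (1 / p) := by
      intro l
      have hb' : ∀ i, 0 ≤ if α i = l then b i else 0 := fun i => by
        split_ifs <;> simp [hb]
      have hc' : ∀ i, 0 ≤ if β i = l then c i else 0 := fun i => by
        split_ifs <;> simp [hc]
      by_cases hl : ∃ i ∈ Ir, α i = l
      · obtain ⟨i, hi, hil⟩ := hl
        obtain ⟨hiI, hiR⟩ := Finset.mem_filter.1 hi
        obtain ⟨hRi, hβi⟩ := hαβ1 i hiR
        have hRl : R i l := hil ▸ hRi
        -- A set to which a rich block is charged meets nothing else, so the other blocks vanish on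
        -- it.
        have e1 : ∑ i ∈ In, restr (E l) (y i) = 0 := by
          refine Finset.sum_eq_zero fun i' hi' => ?_
          obtain ⟨hi'I, hi'R⟩ := Finset.mem_filter.1 hi'
          by_contra h0
          exact hi'R (hRl.2 i' hi'I h0 ▸ hiR)
        have e2 : Ir.filter (α · = l) = {i} := by
          ext i'
          simp only [Finset.mem_filter, Finset.mem_singleton]
          constructor
          · rintro ⟨hi', rfl⟩
            obtain ⟨hi'I, hi'R⟩ := Finset.mem_filter.1 hi'
            exact hRl.2 i' hi'I (hαβ1 i' hi'R).1.1
          · rintro rfl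
            exact ⟨hi, hil⟩
        rw [e1, e2, normSeq_zero, mul_zero, zero_add, Finset.sum_singleton]
        refine (h₃ i hiI).trans (add_le_add ?_ ?_)
        · have := le_rpow_sum hp0 hb' hiI
          simpa only [hil, if_true] using this
        · have := le_rpow_sum hp0 hc' hiI
          have hβl : β i = l := hβi.trans hil
          simpa only [hβl, if_true] using this
      · have e2 : Ir.filter (α · = l) = ∅ := by
          rw [Finset.filter_eq_empty_iff]
          intro i hi h
          exact hl ⟨i, hi, h⟩
        rw [e2, Finset.sum_empty, add_zero]
        set J := In.filter fun i => restr (E l) (y i) ≠ 0 with hJ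
        have hJm : ∀ i ∈ J, i ∈ I ∧ (¬ ∃ l, R i l) ∧ restr (E l) (y i) ≠ 0 := by
          intro i hi
          simp only [hJ, hIn, Finset.mem_filter] at hi
          exact ⟨hi.1.1, hi.1.2, hi.2⟩
        have e1 : ∑ i ∈ In, restr (E l) (y i) = ∑ i ∈ J, restr (E l) (y i) := by
          rw [hJ, Finset.sum_filter_ne_zero]
        have hle : ∀ i, tNorm d θ (restr (E l) (y i)) ≤ tNorm d θ (y i) :=
          fun i => tNorm_restr_le d θ _ _
        -- A block that is not the first in $J$ cannot meet a set before $E_l$, by `cross`; hence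
        -- $\alpha(i)=l$ and $b_i$ is available. Symmetrically, a block that is not the last has
        -- $\beta(i)=l$.
        have key := ih J (fun i => restr (E l) (y i))
          (fun i hi i' hi' hii e he f hf => hy i (hJm i hi).1 i' (hJm i' hi').1 hii e
            (mem_support_restr.1 he).1 f (mem_support_restr.1 hf).1)
          (fun i => if α i = l then b i else 0) (fun i => if β i = l then c i else 0) hb' hc'
          (by
            intro i hi i' hi' hii
            obtain ⟨hiI, hiR, hil⟩ := hJm i hi
            obtain ⟨hi'I, hi'R, hi'l⟩ := hJm i' hi'
            obtain ⟨ha, -, hb1, -⟩ := hαβ2 i hiR l hil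
            have : α i = l := by
              by_contra hne
              exact cross i' hi'I i hiI _ l hii (lt_of_le_of_ne ha hne) hi'l hb1
            simp only [this, if_true]
            exact (hle i).trans (h₁ i hiI i' hi'I hii))
          (by
            intro i hi i' hi' hii
            obtain ⟨hiI, hiR, hil⟩ := hJm i hi
            obtain ⟨hi'I, hi'R, hi'l⟩ := hJm i' hi'
            obtain ⟨-, ha, -, hb1⟩ := hαβ2 i hiR l hil
            have : β i = l := by
              by_contra hne
              exact cross i hiI i' hi'I l _ hii (lt_of_le_of_ne ha (Ne.symm hne)) hb1 hi'l
            simp only [this, if_true]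
            exact (hle i).trans (h₂ i hiI i' hi'I hii))
          (by
            intro i hi
            obtain ⟨hiI, hiR, hil⟩ := hJm i hi
            obtain ⟨ha1, ha2, hb1, hb2⟩ := hαβ2 i hiR l hil
            -- As $y_i$ is not rich, each set that meets it meets a second block. If $y_i$ continues
            -- beyond $E_l$ on one side, `cross` forces that second block in $E_l$ to the other
            -- side, so a single weight suffices; if it continued on both sides there would be a
            -- contradiction.
            have other : ∀ l', restr (E l') (y i) ≠ 0 →
                ∃ i' ∈ I, restr (E l') (y i') ≠ 0 ∧ i' ≠ i := by
              intro l' hl'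
              by_contra! h0
              exact hiR ⟨l', hl', h0⟩
            refine (hle i).trans ?_
            by_cases hα1 : α i = l <;> by_cases hβ1 : β i = l
            · simp only [hα1, hβ1, if_true]
              exact h₃ i hiI
            · simp only [hα1, hβ1, if_true, if_false, add_zero]
              obtain ⟨i', hi'I, hi'l, hne⟩ := other l hil
              rcases lt_or_gt_of_ne hne with h | h
              · exact h₁ i hiI i' hi'I h
              · exact (cross i hiI i' hi'I l _ h (lt_of_le_of_ne ha2 (Ne.symm hβ1)) hb2
                  hi'l).elim
            · simp only [hα1, hβ1, if_true, if_false, zero_add]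
              obtain ⟨i', hi'I, hi'l, hne⟩ := other l hil
              rcases lt_or_gt_of_ne hne with h | h
              · exact (cross i' hi'I i hiI _ l h (lt_of_le_of_ne ha1 hα1) hi'l hb1).elim
              · exact h₂ i hiI i' hi'I h
            · obtain ⟨i', hi'I, hi'l, hne⟩ := other l hil
              rcases lt_or_gt_of_ne hne with h | h
              · exact (cross i' hi'I i hiI _ l h (lt_of_le_of_ne ha1 hα1) hi'l hb1).elim
              · exact (cross i hiI i' hi'I l _ h (lt_of_le_of_ne ha2 (Ne.symm hβ1)) hb2
                  hi'l).elim)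
        rw [e1]
        refine (mul_le_mul_of_nonneg_left key hθ.le).trans ?_
        rw [← mul_assoc, mul_one_div_cancel hθ.ne', one_mul]
        have hJI : J ⊆ I := fun i hi => (hJm i hi).1
        refine add_le_add ?_ ?_ <;>
          refine Real.rpow_le_rpow (Finset.sum_nonneg fun i _ => Real.rpow_nonneg ?_ _)
            (Finset.sum_le_sum_of_subset_of_nonneg hJI fun i _ _ => Real.rpow_nonneg ?_ _)
            (one_div_nonneg.2 hp0.le)
        · exact hb' i
        · exact hb' i
        · exact hc' i
        · exact hc' i
    have split : ∀ l, restr (E l) (∑ i ∈ I, y i) =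
        ∑ i ∈ Ir, restr (E l) (y i) + ∑ i ∈ In, restr (E l) (y i) := fun l => by
      rw [restr_sum, hIr, hIn, Finset.sum_filter_add_sum_filter_not]
    calc θ * ∑ l, normSeq d θ j (restr (E l) (∑ i ∈ I, y i))
        ≤ θ * ∑ l, (∑ i ∈ Ir, normSeq d θ j (restr (E l) (y i)) +
            normSeq d θ j (∑ i ∈ In, restr (E l) (y i))) := by
          refine mul_le_mul_of_nonneg_left (Finset.sum_le_sum fun l _ => ?_) hθ.le
          rw [split]
          exact (normSeq_add d θ j _ _).trans
            (add_le_add_left (normSeq_sum_le d θ j Ir _) _)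
      _ = ∑ i ∈ Ir, θ * ∑ l, normSeq d θ j (restr (E l) (y i)) +
            ∑ l, θ * normSeq d θ j (∑ i ∈ In, restr (E l) (y i)) := by
          rw [Finset.sum_add_distrib, mul_add, Finset.sum_comm, Finset.mul_sum, Finset.mul_sum]
      -- Here the factor $\theta$ is consumed for the rich blocks.
      _ ≤ ∑ i ∈ Ir, tNorm d θ (y i) +
            ∑ l, θ * normSeq d θ j (∑ i ∈ In, restr (E l) (y i)) :=
          add_le_add_left
            (Finset.sum_le_sum fun i _ => sum_normSeq_restr_le d θ hm1 hmd hE j (y i)) _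
      _ = ∑ l, (θ * normSeq d θ j (∑ i ∈ In, restr (E l) (y i)) +
            ∑ i ∈ Ir.filter (α · = l), tNorm d θ (y i)) := by
          rw [Finset.sum_add_distrib, add_comm, Finset.sum_fiberwise]
      _ ≤ ∑ l, ((∑ i ∈ I, (if α i = l then b i else 0) ^ p) ^ (1 / p) +
          (∑ i ∈ I, (if β i = l then c i else 0) ^ p) ^ (1 / p)) :=
          Finset.sum_le_sum fun l _ => step l
      _ ≤ _ := by
          rw [Finset.sum_add_distrib, one_div_mul_eq_div, le_div_iff₀' hθ, mul_add]
          exact add_le_add (mul_sum_fiber_rpow_le hp hdp hd hmd I α b hb)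
            (mul_sum_fiber_rpow_le hp hdp hd hmd I β c hc)

theorem tNorm_sum_le (hp : 1 < p) (hdp : (d : ℝ) * (θ : ℝ) = (d : ℝ) ^ (1 / p))
    (hd : 0 < d) (I : Finset ℕ) (y : ℕ → Ome k →₀ ℝ)
    (hy : ∀ i ∈ I, ∀ i' ∈ I, i < i' → Successive (y i).support (y i').support) :
    tNorm d θ (∑ i ∈ I, y i) ≤ 2 / θ * (∑ i ∈ I, tNorm d θ (y i) ^ p) ^ (1 / p) := by
  have hnn : ∀ i, 0 ≤ tNorm d θ (y i) := fun i => tNorm_nonneg d θ _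
  have hθ := θ.2.1
  refine Real.iSup_le (fun j => ?_) (mul_nonneg (by positivity)
    (Real.rpow_nonneg (Finset.sum_nonneg fun i _ => Real.rpow_nonneg (hnn i) _) _))
  -- Both weights are the norms themselves, whence the factor 2.
  refine (normSeq_sum_le_weights hp hdp hd j I y hy _ _ hnn hnn (fun _ _ _ _ _ => le_rfl)
    (fun _ _ _ _ _ => le_rfl) (fun i _ => by linarith [hnn i])).trans_eq ?_
  ring

end

/-! ### The maximal members of $\mathcal E_k$ and their initial segments -/

/-- The composition underlying `Xmax`: the coordinates of `v` where `s` vanishes, and the entries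
of `s` shifted by the last entry of `v` elsewhere. -/
def shiftMap (v s : List ℕ) : List ℕ :=
  List.zipWith (fun n m => if m = 0 then n else v.getLastD 0 + m) v s

theorem length_shiftMap {v s : List ℕ} (h : s.length ≤ v.length) :
    (shiftMap v s).length = s.length := by
  simp [shiftMap, h]

theorem getLastD_eq_getElem {s : List ℕ} (h : s ≠ []) :
    s.getLastD 0 = s[s.length - 1]'(Nat.sub_lt (List.length_pos_iff.2 h) one_pos) := by
  rw [List.getLastD_eq_getLast?, List.getLast?_eq_getLast_of_ne_nil h, Option.getD_some,
    List.getLast_eq_getElem]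

theorem le_getLastD {s : List ℕ} (h : s.Pairwise (· ≤ ·)) : ∀ n ∈ s, n ≤ s.getLastD 0 := by
  intro n hn
  have hne : s ≠ [] := List.ne_nil_of_mem hn
  obtain ⟨i, hi, rfl⟩ := List.getElem_of_mem hn
  rw [getLastD_eq_getElem hne]
  rcases Nat.lt_or_ge i (s.length - 1) with h' | h'
  · exact List.pairwise_iff_getElem.1 h _ _ _ _ h'
  · have : i = s.length - 1 := by omega
    subst this
    exact le_rfl

theorem getElem_shiftMap {v s : List ℕ} {i : ℕ} (h : i < (shiftMap v s).length) (hv : i < v.length)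
    (hs : i < s.length) :
    (shiftMap v s)[i] = if s[i] = 0 then v[i] else v.getLastD 0 + s[i] := by
  simp [shiftMap]

theorem getLastD_shiftMap {v s : List ℕ} (h : s.length ≤ v.length) (hs : s ≠ []) :
    (shiftMap v s).getLastD 0 = if s.getLastD 0 = 0 then
      v[s.length - 1]'(by have := List.length_pos_iff.2 hs; omega)
      else v.getLastD 0 + s.getLastD 0 := by
  have hp := List.length_pos_iff.2 hs
  have hl := length_shiftMap h
  have hne : shiftMap v s ≠ [] := by rw [← List.length_pos_iff]; omega
  rw [getLastD_eq_getElem hne, getElem_shiftMap _ (by omega) (by omega), getLastD_eq_getElem hs]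
  simp only [hl]

theorem getLastD_shiftMap_of_length_eq {v s : List ℕ} (h : s.length = v.length) :
    (shiftMap v s).getLastD 0 = v.getLastD 0 + s.getLastD 0 := by
  rcases eq_or_ne s [] with rfl | hs
  · have : v = [] := List.length_eq_zero_iff.1 h.symm
    subst this
    simp [shiftMap]
  · have hv : v ≠ [] := by rw [← List.length_pos_iff, ← h]; exact List.length_pos_iff.2 hs
    rw [getLastD_shiftMap h.le hs]
    split_ifs with h0
    · rw [h0, add_zero, getLastD_eq_getElem hv]
      simp only [h]
    · rfl

theorem shiftMap_pairwise {v s : List ℕ} (hv : v.Pairwise (· ≤ ·)) (hs : s.Pairwise (· ≤ ·))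
    (h : s.length ≤ v.length) : (shiftMap v s).Pairwise (· ≤ ·) := by
  rw [List.pairwise_iff_getElem]
  intro i j hi hj hij
  have hl := length_shiftMap h
  rw [getElem_shiftMap _ (by omega) (by omega), getElem_shiftMap _ (by omega) (by omega)]
  have h1 : s[i] ≤ s[j] := List.pairwise_iff_getElem.1 hs _ _ _ _ hij
  have h2 : v[i] ≤ v[j] := List.pairwise_iff_getElem.1 hv _ _ _ _ hij
  have h3 : v[i] ≤ v.getLastD 0 := le_getLastD hv _ (List.getElem_mem _)
  split_ifs <;> omega

/-- Last entries add up under the shift, so an entry moved twice receives the same total; an entry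
of the composite is unmoved only if both are zero. This makes the maximal members nested. -/
theorem shiftMap_shiftMap {v t s : List ℕ} (ht : t.length = v.length) (hs : s.length = t.length) :
    shiftMap (shiftMap v t) s = shiftMap v (shiftMap t s) := by
  have h1 := length_shiftMap (v := v) (s := t) ht.le
  have h2 := length_shiftMap (v := t) (s := s) hs.le
  have h3 := length_shiftMap (v := shiftMap v t) (s := s) (by omega)
  have h4 := length_shiftMap (v := v) (s := shiftMap t s) (by omega)
  refine List.ext_getElem (by omega) fun i hi hi' => ?_
  rw [getElem_shiftMap _ (by omega) (by omega), getElem_shiftMap _ (by omega) (by omega),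
    getElem_shiftMap _ (by omega) (by omega), getElem_shiftMap _ (by omega) (by omega),
    getLastD_shiftMap_of_length_eq ht]
  split_ifs <;> omega

theorem lex_zipWith {g : ℕ → ℕ → ℕ} {s t : List ℕ} (h : List.Lex (· < ·) s t) :
    ∀ v : List ℕ, (∀ n ∈ v, ∀ a b, a < b → g n a < g n b) → t.length ≤ v.length →
      List.Lex (· < ·) (List.zipWith g v s) (List.zipWith g v t) := by
  induction h with
  | nil =>
    rintro (_ | ⟨n, v⟩) hg hl
    · simp at hl
    · simp only [List.zipWith_cons_cons, List.zipWith_nil_right]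
      exact List.Lex.nil
  | cons _ ih =>
    rintro (_ | ⟨n, v⟩) hg hl
    · simp at hl
    · simp only [List.zipWith_cons_cons]
      exact List.Lex.cons (ih v (fun n hn => hg n (List.mem_cons_of_mem _ hn)) (by simpa using hl))
  | rel h =>
    rintro (_ | ⟨n, v⟩) hg hl
    · simp at hl
    · simp only [List.zipWith_cons_cons]
      exact List.Lex.rel (hg n List.mem_cons_self _ _ h)

theorem length_le_of_lex_of_eq_zero {s t : List ℕ} (h : List.Lex (· < ·) s t)
    (ht : ∀ n ∈ t, n = 0) : s.length ≤ t.length := by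
  induction h with
  | nil => simp
  | cons _ ih => simpa using ih fun n hn => ht n (List.mem_cons_of_mem _ hn)
  | rel h => exact absurd (ht _ List.mem_cons_self) (by omega)

/-- Shifted last entries exceed every entry of $v$, so only two zero last entries are delicate. Then
both sequences are constantly zero, the lexicographically smaller is no longer than the other, and
the monotonicity of $v$ decides, with the lexicographic order breaking ties. -/
theorem prec_shiftMap {v s t : List ℕ} (hv : v.Pairwise (· ≤ ·)) (ht' : t.Pairwise (· ≤ ·))
    (hs : s.length ≤ v.length) (ht : t.length ≤ v.length) (h : Prec s t) :
    Prec (shiftMap v s) (shiftMap v t) := by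
  have ne : ∀ {u : List ℕ}, u ≠ [] → u.length ≤ v.length → shiftMap v u ≠ [] := by
    intro u hu hl
    rw [← List.length_pos_iff, length_shiftMap hl]
    exact List.length_pos_iff.2 hu
  rcases h with ⟨rfl, h⟩ | ⟨hs0, ht0, h⟩
  · exact Or.inl ⟨by simp [shiftMap], ne h ht⟩
  refine Or.inr ⟨ne hs0 hs, ne ht0 ht, ?_⟩
  rw [getLastD_shiftMap hs hs0, getLastD_shiftMap ht ht0]
  have hle : ∀ (i : ℕ) (hi : i < v.length), v[i] ≤ v.getLastD 0 :=
    fun i hi => le_getLastD hv _ (List.getElem_mem _)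
  have hsp := List.length_pos_iff.2 hs0
  rcases h with h | ⟨h, hl⟩
  · left
    have := hle (s.length - 1) (by omega)
    split_ifs <;> omega
  · have lex : List.Lex (· < ·) (shiftMap v s) (shiftMap v t) := by
      refine lex_zipWith hl v (fun n hn a b hab => ?_) ht
      have := le_getLastD hv n hn
      split_ifs <;> omega
    rw [h]
    split_ifs with h0
    · have hts : s.length ≤ t.length :=
        length_le_of_lex_of_eq_zero hl fun n hn => by have := le_getLastD ht' n hn; omega
      have : v[s.length - 1] ≤ v[t.length - 1] := by
        rcases hts.eq_or_lt with he | hlt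
        · simp only [he]; exact le_rfl
        · exact List.pairwise_iff_getElem.1 hv _ _ _ _ (by omega)
      rcases this.eq_or_lt with he | hlt
      · exact Or.inr ⟨he, lex⟩
      · exact Or.inl hlt
    · exact Or.inr ⟨rfl, lex⟩

theorem properInit_shiftMap {v s t : List ℕ} (hs : s.length ≤ v.length) (ht : t.length ≤ v.length)
    (h : ProperInit s t) : ProperInit (shiftMap v s) (shiftMap v t) := by
  refine ⟨?_, by rw [length_shiftMap hs, length_shiftMap ht]; exact h.2⟩
  obtain ⟨u, rfl⟩ := h.1
  rw [List.prefix_iff_eq_take]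
  refine List.ext_getElem ?_ fun i hi hi' => ?_
  · rw [List.length_take, length_shiftMap hs, length_shiftMap ht]
    exact (min_eq_left (by simp)).symm
  · rw [length_shiftMap hs] at hi
    rw [List.getElem_take, getElem_shiftMap _ (by omega) hi,
      getElem_shiftMap _ (by omega) (by simp; omega), List.getElem_append_left hi]

theorem prec_or_eq_replicate {t : List ℕ} (ht : t.Pairwise (· ≤ ·)) :
    t = List.replicate t.length 0 ∨ Prec (List.replicate t.length 0) t := by
  rcases eq_or_ne t [] with rfl | hne
  · exact Or.inl rfl
  rcases Nat.eq_zero_or_pos (t.getLastD 0) with h0 | h0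
  · left
    rw [List.eq_replicate_iff]
    exact ⟨rfl, fun n hn => by have := le_getLastD ht n hn; omega⟩
  · refine Or.inr (Or.inr ⟨by simpa using hne, hne, Or.inl ?_⟩)
    rw [getLastD_eq_getElem (by simpa using hne)]
    simpa using h0

theorem shiftMap_replicate (v : List ℕ) : shiftMap v (List.replicate v.length 0) = v := by
  refine List.ext_getElem (by simp [shiftMap]) fun i hi hi' => ?_
  rw [getElem_shiftMap _ hi' (by simpa using hi')]
  simp

variable {k : ℕ}

theorem mem_Xmax {v w : Ome k} : w ∈ Xmax v ↔ ∃ t : Ome k, w.1 = shiftMap v.1 t.1 := Iff.rfl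

theorem precEq_of_mem_Xmax {v w : Ome k} (h : w ∈ Xmax v) : PrecEq v.1 w.1 := by
  obtain ⟨t, ht⟩ := mem_Xmax.1 h
  have hlen : t.1.length = v.1.length := t.2.1.trans v.2.1.symm
  rcases prec_or_eq_replicate t.2.2 with h0 | h0
  · right
    rw [ht, h0, hlen, shiftMap_replicate]
  · left
    have := prec_shiftMap v.2.2 t.2.2 (by simp [hlen]) hlen.le h0
    rwa [hlen, shiftMap_replicate, ← ht] at this

theorem self_mem_Xmax (v : Ome k) : v ∈ Xmax v :=
  ⟨⟨List.replicate k 0, by simp, by simp [List.pairwise_replicate]⟩, by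
    have := shiftMap_replicate v.1
    rw [v.2.1] at this
    exact this.symm⟩

theorem Xmax_subset {v v' : Ome k} (h : v' ∈ Xmax v) : Xmax v' ⊆ Xmax v := by
  intro w hw
  obtain ⟨t, ht⟩ := mem_Xmax.1 h
  obtain ⟨s, hs⟩ := mem_Xmax.1 hw
  have hst : s.1.length = t.1.length := s.2.1.trans t.2.1.symm
  have htv : t.1.length = v.1.length := t.2.1.trans v.2.1.symm
  refine ⟨⟨shiftMap t.1 s.1, (length_shiftMap hst.le).trans s.2.1,
    shiftMap_pairwise t.2.2 s.2.2 hst.le⟩, ?_⟩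
  rw [hs, ht]
  exact shiftMap_shiftMap htv hst

theorem exists_tree_body_eq_Xmax (v : Ome k) :
    ∃ X : Omle k → Omle k, IsEllentuckTree X ∧ body X = Xmax v := by
  have hl : ∀ s : Omle k, s.1.length ≤ v.1.length := fun s => s.2.1.trans v.2.1.ge
  refine ⟨fun s => ⟨shiftMap v.1 s.1, (length_shiftMap (hl s)).trans_le s.2.1,
    shiftMap_pairwise v.2.2 s.2.2 (hl s)⟩, ⟨fun s t h =>
      prec_shiftMap v.2.2 t.2.2 (hl s) (hl t) h, fun s t h =>
      properInit_shiftMap (hl s) (hl t) h⟩, ?_⟩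
  ext w
  exact ⟨fun ⟨u, hu⟩ => ⟨u, hu.symm⟩, fun ⟨u, hu⟩ => ⟨u, hu.symm⟩⟩

/-- The last entry is the largest, so everything below $v$ has entries at most the last entry of
$v$. -/
theorem finite_setOf_prec (v : Ome k) : {w : Ome k | Prec w.1 v.1}.Finite := by
  have hfin : ((fun l : List (Fin (v.1.getLastD 0 + 1)) => l.map Fin.val) ''
      {l | l.length = k}).Finite := (List.finite_length_eq _ k).image _
  refine Set.Finite.of_finite_image (f := Subtype.val) (hfin.subset ?_)
    Subtype.val_injective.injOn
  rintro _ ⟨w, hw, rfl⟩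
  have hle : ∀ n ∈ w.1, n < v.1.getLastD 0 + 1 := by
    intro n hn
    have h1 := le_getLastD w.2.2 n hn
    rcases hw with ⟨h, _⟩ | ⟨_, _, h | ⟨h, _⟩⟩
    · rw [h] at hn; simp at hn
    · omega
    · omega
  refine ⟨w.1.pmap (fun n h => ⟨n, h⟩) hle, by simp [w.2.1], ?_⟩
  simp [List.map_pmap]

/-- The finite initial segment of `Xmax v` below `w`. -/
noncomputable def segment (v w : Ome k) : Finset (Ome k) :=
  (Set.Finite.inter_of_right (finite_setOf_prec w) (Xmax v)).toFinset

theorem mem_segment {v w e : Ome k} : e ∈ segment v w ↔ e ∈ Xmax v ∧ Prec e.1 w.1 := by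
  simp [segment]

/-- The shift by $v$ is itself a tree with range `Xmax v`, so cutting that range at $w$ leaves an
initial segment. -/
theorem isApprox_segment (v w : Ome k) : IsApprox (segment v w) := by
  obtain ⟨X, hX, hb⟩ := exists_tree_body_eq_Xmax v
  refine ⟨X, hX, fun e he => hb ▸ (mem_segment.1 he).1, fun u hu e he h => ?_⟩
  exact mem_segment.2 ⟨hb ▸ hu, h.trans (mem_segment.1 he).2⟩

theorem PrecEq.trans_prec {s t u : List ℕ} (h : PrecEq s t) (h' : Prec t u) : Prec s u := by
  rcases h with h | rfl
  · exact h.trans h'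
  · exact h'

theorem Prec.trans_precEq {s t u : List ℕ} (h : Prec s t) (h' : PrecEq t u) : Prec s u := by
  rcases h' with h' | rfl
  · exact h.trans h'
  · exact h

/-! ### Partial sums cut out by segments -/

section

variable {d : ℕ} {θ : Set.Ioo (0 : ℝ) 1} {x : ℕ → Ome k →₀ ℝ} {v : ℕ → Ome k}

theorem mem_Xmax_of_le (hv : ∀ i, v (i + 1) ∈ Xmax (v i)) {i j : ℕ} (h : i ≤ j) :
    v j ∈ Xmax (v i) := by
  induction h with
  | refl => exact self_mem_Xmax _
  | step _ ih => exact Xmax_subset ih (hv _)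

/-- The norm of the part of `∑ a_i x_i` over `s ≤ i < t`. -/
noncomputable def blockNorm (d : ℕ) (θ : ℝ) (x : ℕ → Ome k →₀ ℝ) (a : ℕ → ℝ) (s t : ℕ) : ℝ :=
  tNorm d θ (∑ i ∈ Finset.Ico s t, a i • x i)

theorem restr_segment_eq_self (hxv : ∀ i, ∀ w ∈ (x i).support, PrecEq (v i).1 w.1 ∧
      Prec w.1 (v (i + 1)).1)
    (hx : ∀ i, ∀ w ∈ (x i).support, w ∈ Xmax (v i)) (hv : ∀ i, v (i + 1) ∈ Xmax (v i))
    {s t i : ℕ} (hs : s ≤ i) (ht : i < t) : restr (segment (v s) (v t)) (x i) = x i :=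
  restr_eq_self fun w hw => mem_segment.2 ⟨Xmax_subset (mem_Xmax_of_le hv hs) (hx i w hw),
    (hxv i w hw).2.trans_precEq (precEq_of_mem_Xmax (mem_Xmax_of_le hv ht))⟩

theorem restr_segment_eq_zero (hxv : ∀ i, ∀ w ∈ (x i).support, PrecEq (v i).1 w.1 ∧
      Prec w.1 (v (i + 1)).1) (hv : ∀ i, v (i + 1) ∈ Xmax (v i))
    {s t i : ℕ} (h : i < s ∨ t ≤ i) : restr (segment (v s) (v t)) (x i) = 0 := by
  refine restr_eq_zero fun w hw hm => ?_
  obtain ⟨h1, h2⟩ := mem_segment.1 hm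
  rcases h with h | h
  · exact prec_irrefl _ (((hxv i w hw).2.trans_precEq
      (precEq_of_mem_Xmax (mem_Xmax_of_le hv h))).trans_precEq (precEq_of_mem_Xmax h1))
  · exact prec_irrefl _ ((precEq_of_mem_Xmax (mem_Xmax_of_le hv h)).trans_prec
      ((hxv i w hw).1.trans_prec h2))

theorem restr_segment_sum (hxv : ∀ i, ∀ w ∈ (x i).support, PrecEq (v i).1 w.1 ∧
      Prec w.1 (v (i + 1)).1)
    (hx : ∀ i, ∀ w ∈ (x i).support, w ∈ Xmax (v i)) (hv : ∀ i, v (i + 1) ∈ Xmax (v i))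
    (a : ℕ → ℝ) {s t s' t' : ℕ} (hs : s ≤ s') (ht : t' ≤ t) :
    restr (segment (v s') (v t')) (∑ i ∈ Finset.Ico s t, a i • x i) =
      ∑ i ∈ Finset.Ico s' t', a i • x i := by
  rw [restr_sum, ← Finset.sum_subset (Finset.Ico_subset_Ico hs ht)]
  · refine Finset.sum_congr rfl fun i hi => ?_
    rw [Finset.mem_Ico] at hi
    rw [restr_smul, restr_segment_eq_self hxv hx hv hi.1 hi.2]
  · intro i _ hi
    rw [Finset.mem_Ico, not_and_or, not_le, not_lt] at hi
    rw [restr_smul, restr_segment_eq_zero hxv hv hi, smul_zero]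

theorem blockNorm_mono (hxv : ∀ i, ∀ w ∈ (x i).support, PrecEq (v i).1 w.1 ∧
      Prec w.1 (v (i + 1)).1)
    (hx : ∀ i, ∀ w ∈ (x i).support, w ∈ Xmax (v i)) (hv : ∀ i, v (i + 1) ∈ Xmax (v i))
    (a : ℕ → ℝ) {s t s' t' : ℕ} (hs : s ≤ s') (ht : t' ≤ t) :
    blockNorm d θ x a s' t' ≤ blockNorm d θ x a s t := by
  unfold blockNorm
  rw [← restr_segment_sum hxv hx hv a hs ht]
  exact tNorm_restr_le d θ _ _

theorem blockNorm_of_le (a : ℕ → ℝ) {s t : ℕ} (h : t ≤ s) : blockNorm d θ x a s t = 0 := by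
  rw [blockNorm, Finset.Ico_eq_empty_of_le h, Finset.sum_empty, tNorm_eq_zero]

/-- The segments from $v_{s_l}$ to $v_{s_{l+1}}$ are admissible, and each restricts the full sum to
its own range of blocks. -/
theorem sum_blockNorm_le (hx0 : ∀ i, x i ≠ 0)
    (hxv : ∀ i, ∀ w ∈ (x i).support, PrecEq (v i).1 w.1 ∧ Prec w.1 (v (i + 1)).1)
    (hx : ∀ i, ∀ w ∈ (x i).support, w ∈ Xmax (v i)) (hv : ∀ i, v (i + 1) ∈ Xmax (v i))
    (a : ℕ → ℝ) (s : ℕ → ℕ) (hs : Monotone s) :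
    θ * ∑ l ∈ Finset.range d, blockNorm d θ x a (s l) (s (l + 1)) ≤
      blockNorm d θ x a (s 0) (s d) := by
  classical
  -- Admissible sets must be nonempty, so empty ranges are dropped and the others renumbered; at
  -- most $d$ remain.
  set T := (Finset.range d).filter fun l => s l < s (l + 1) with hT
  have hsum : ∑ l ∈ Finset.range d, blockNorm d θ x a (s l) (s (l + 1)) =
      ∑ l ∈ T, blockNorm d θ x a (s l) (s (l + 1)) := by
    rw [hT, Finset.sum_filter]
    refine Finset.sum_congr rfl fun l _ => ?_
    split_ifs with h
    · rfl
    · exact blockNorm_of_le a (not_lt.1 h)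
  rw [hsum]
  rcases T.eq_empty_or_nonempty with h0 | hne
  · rw [h0, Finset.sum_empty, mul_zero]
    exact tNorm_nonneg d θ _
  set e := T.orderEmbOfFin rfl with he
  have hmem : ∀ l, e l ∈ T := fun l => T.orderEmbOfFin_mem rfl l
  have hmem' : ∀ l, e l < d ∧ s (e l) < s (e l + 1) := fun l => by
    have := hmem l
    simpa [hT] using this
  have hE : Admissible fun l : Fin T.card => segment (v (s (e l))) (v (s (e l + 1))) := by
    refine ⟨fun l => ⟨?_, isApprox_segment _ _⟩, fun l l' hll f hf f' hf' => ?_⟩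
    -- A nonzero block lies between consecutive $v_i$, which makes $v_{s_l}$ strictly below the cut
    -- and hence a member of the segment.
    · obtain ⟨w, hw⟩ := Finsupp.support_nonempty_iff.2 (hx0 (s (e l)))
      refine ⟨v (s (e l)), mem_segment.2 ⟨self_mem_Xmax _, ?_⟩⟩
      exact ((hxv _ w hw).1.trans_prec (hxv _ w hw).2).trans_precEq
        (precEq_of_mem_Xmax (mem_Xmax_of_le hv (hmem' l).2))
    · have h1 : s (e l + 1) ≤ s (e l') := hs (e.strictMono hll)
      exact ((mem_segment.1 hf).2.trans_precEq
        (precEq_of_mem_Xmax (mem_Xmax_of_le hv h1))).trans_precEq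
        (precEq_of_mem_Xmax (mem_segment.1 hf').1)
  have key := sum_tNorm_restr_le d θ (m := T.card) hne.card_pos
    ((Finset.card_filter_le _ _).trans_eq (Finset.card_range d)) hE
    (∑ i ∈ Finset.Ico (s 0) (s d), a i • x i)
  refine le_trans (le_of_eq ?_) key
  congr 1
  have : ∑ l ∈ T, blockNorm d θ x a (s l) (s (l + 1)) =
      ∑ l : Fin T.card, blockNorm d θ x a (s (e l)) (s (e l + 1)) := by
    conv_lhs => rw [← Finset.map_orderEmbOfFin_univ T rfl]
    rw [Finset.sum_map]
    rfl
  rw [this]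
  refine Finset.sum_congr rfl fun l _ => ?_
  rw [restr_segment_sum hxv hx hv a (hs (Nat.zero_le _)) (hs (hmem' l).1)]
  rfl

end

/-! ### The lower estimate by repeated division into $d$ parts -/

theorem sum_sum_Ico_of_monotone {M : Type*} [AddCommMonoid M] (f : ℕ → M) {s : ℕ → ℕ}
    (hs : Monotone s) (d : ℕ) :
    ∑ l ∈ Finset.range d, ∑ i ∈ Finset.Ico (s l) (s (l + 1)), f i =
      ∑ i ∈ Finset.Ico (s 0) (s d), f i := by
  induction d with
  | zero => simp
  | succ d ih =>
    rw [Finset.sum_range_succ, ih, Finset.sum_Ico_consecutive f (hs (Nat.zero_le _))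
      (hs (Nat.le_succ _))]

theorem exists_le_or_le (n : ℕ) (u : ℕ → ℝ) (β : ℝ) : ∃ i, n ≤ i ∨ β ≤ u i := ⟨n, Or.inl le_rfl⟩

open Classical in
/-- For non-decreasing `u`, the number of `i < n` with `u i < β`. -/
noncomputable def cut (n : ℕ) (u : ℕ → ℝ) (β : ℝ) : ℕ := Nat.find (exists_le_or_le n u β)

theorem lt_cut {n : ℕ} {u : ℕ → ℝ} (hu : Monotone u) {β : ℝ} {i : ℕ} :
    i < cut n u β ↔ i < n ∧ u i < β := by
  classical
  rw [cut, Nat.lt_find_iff]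
  constructor
  · intro h
    simpa using h i le_rfl
  · rintro ⟨h1, h2⟩ j hj h
    rcases h with h | h
    · omega
    · linarith [hu hj]

theorem cut_le (n : ℕ) (u : ℕ → ℝ) (β : ℝ) : cut n u β ≤ n := by
  classical
  exact Nat.find_min' _ (Or.inl le_rfl)

theorem cut_mono (n : ℕ) {u : ℕ → ℝ} (hu : Monotone u) : Monotone (cut n u) := by
  intro β γ h
  by_contra! h'
  obtain ⟨h1, h2⟩ := (lt_cut hu).1 h'
  exact lt_irrefl _ ((lt_cut hu).2 ⟨h1, h2.trans_le h⟩)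

theorem mem_Ico_cut {n : ℕ} {u : ℕ → ℝ} (hu : Monotone u) {β γ : ℝ} {i : ℕ} :
    i ∈ Finset.Ico (cut n u β) (cut n u γ) ↔ i < n ∧ β ≤ u i ∧ u i < γ := by
  rw [Finset.mem_Ico, lt_cut hu, ← not_lt, lt_cut hu]
  constructor
  · rintro ⟨h1, h2, h3⟩
    exact ⟨h2, not_lt.1 fun h => h1 ⟨h2, h⟩, h3⟩
  · rintro ⟨h1, h2, h3⟩
    exact ⟨fun h => absurd h.2 (not_lt.2 h2), h1, h3⟩

section

variable {d : ℕ} {θ : ℝ} {F : ℕ → ℕ → ℝ}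

/-- Each division of the window $[\alpha,\alpha+L)$ into $d$ equal windows costs one factor
$\theta$. After $\sigma_i$ divisions the length is at most $q_i$, so the window holding $u_i$ holds
no other point and monotonicity of $F$ ends the recursion. Indices with $F(i,i+1)=0$ are exempt, as
they need never be isolated. -/
theorem sum_pow_mul_le_cut (hd : 0 < d) (hθ : 0 ≤ θ) (hF : ∀ s t, 0 ≤ F s t)
    (hmono : ∀ s t s' t', s ≤ s' → t' ≤ t → F s' t' ≤ F s t)
    (hsum : ∀ s : ℕ → ℕ, Monotone s →
      θ * ∑ l ∈ Finset.range d, F (s l) (s (l + 1)) ≤ F (s 0) (s d))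
    (n : ℕ) {u : ℕ → ℝ} (hu : Monotone u) (q : ℕ → ℝ)
    (hq : ∀ i i', i ≠ i' → q i ≤ |u i - u i'|) (T : ℕ) (α L : ℝ) (hL : 0 ≤ L) (σ : ℕ → ℕ)
    (hσ : ∀ i ∈ Finset.Ico (cut n u α) (cut n u (α + L)), F i (i + 1) ≠ 0 →
      σ i ≤ T ∧ L ≤ d ^ σ i * q i) :
    ∑ i ∈ Finset.Ico (cut n u α) (cut n u (α + L)), θ ^ σ i * F i (i + 1) ≤
      F (cut n u α) (cut n u (α + L)) := by
  have hd' : (0 : ℝ) < d := by exact_mod_cast hd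
  induction T generalizing α L σ with
  | zero =>
    by_cases h : ∃ i ∈ Finset.Ico (cut n u α) (cut n u (α + L)), F i (i + 1) ≠ 0
    · obtain ⟨i, hi, hi0⟩ := h
      obtain ⟨h1, h2⟩ := hσ i hi hi0
      have h0 : σ i = 0 := by omega
      rw [h0, pow_zero, one_mul] at h2
      rw [Finset.sum_eq_single_of_mem i hi, h0, pow_zero, one_mul]
      · rw [Finset.mem_Ico] at hi
        exact hmono _ _ _ _ hi.1 hi.2
      · intro i' hi' hne
        have h3 := hq i i' hne.symm
        obtain ⟨-, h4, h5⟩ := (mem_Ico_cut hu).1 hi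
        obtain ⟨-, h6, h7⟩ := (mem_Ico_cut hu).1 hi'
        have : |u i - u i'| < L := abs_lt.2 ⟨by linarith, by linarith⟩
        linarith
    · push Not at h
      rw [Finset.sum_eq_zero fun i hi => by rw [h i hi, mul_zero]]
      exact hF _ _
  | succ T ih =>
    by_cases h : ∃ i ∈ Finset.Ico (cut n u α) (cut n u (α + L)), F i (i + 1) ≠ 0 ∧ σ i = 0
    -- Such a point is already alone in its window, so the sum has one term.
    · obtain ⟨i, hi, hi0, h0⟩ := h
      obtain ⟨h1, h2⟩ := hσ i hi hi0
      rw [h0, pow_zero, one_mul] at h2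
      rw [Finset.sum_eq_single_of_mem i hi, h0, pow_zero, one_mul]
      · rw [Finset.mem_Ico] at hi
        exact hmono _ _ _ _ hi.1 hi.2
      · intro i' hi' hne
        have h3 := hq i i' hne.symm
        obtain ⟨-, h4, h5⟩ := (mem_Ico_cut hu).1 hi
        obtain ⟨-, h6, h7⟩ := (mem_Ico_cut hu).1 hi'
        have : |u i - u i'| < L := abs_lt.2 ⟨by linarith, by linarith⟩
        linarith
    · push Not at h
      set s : ℕ → ℕ := fun l => cut n u (α + l * (L / d)) with hs
      have hLd : 0 ≤ L / d := by positivity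
      have hsm : Monotone s := fun l l' hl => cut_mono n hu (by gcongr)
      have hs0 : s 0 = cut n u α := by simp [hs]
      have hsd : s d = cut n u (α + L) := by
        simp only [hs]
        congr 2
        field_simp
      have hsl : ∀ l, s (l + 1) = cut n u (α + l * (L / d) + L / d) := fun l => by
        simp only [hs]
        congr 1
        push_cast
        ring
      rw [← hs0, ← hsd] at h hσ ⊢
      refine le_trans ?_ (hsum s hsm)
      rw [← sum_sum_Ico_of_monotone _ hsm, Finset.mul_sum]
      refine Finset.sum_le_sum fun l hl => ?_
      have hsub : Finset.Ico (s l) (s (l + 1)) ⊆ Finset.Ico (s 0) (s d) :=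
        Finset.Ico_subset_Ico (hsm (Nat.zero_le _)) (hsm (Finset.mem_range.1 hl))
      have key := ih (α + l * (L / d)) (L / d) hLd (fun i => σ i - 1) (by
        intro i hi hi0
        rw [← hsl] at hi
        have hi' := hsub hi
        have h1 := h i hi' hi0
        obtain ⟨h2, h3⟩ := hσ i hi' hi0
        refine ⟨by omega, ?_⟩
        rw [div_le_iff₀ hd']
        refine h3.trans_eq ?_
        obtain ⟨τ, hτ⟩ := Nat.exists_eq_succ_of_ne_zero h1
        rw [hτ, Nat.succ_sub_one, pow_succ]
        ring)
      rw [← hsl] at key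
      refine le_trans (le_of_eq ?_) (mul_le_mul_of_nonneg_left key hθ)
      rw [Finset.mul_sum]
      refine Finset.sum_congr rfl fun i hi => ?_
      by_cases hi0 : F i (i + 1) = 0
      · rw [hi0]
        ring
      · obtain ⟨τ, hτ⟩ := Nat.exists_eq_succ_of_ne_zero (h i (hsub hi) hi0)
        rw [hτ, Nat.succ_sub_one, pow_succ]
        ring

theorem lower_estimate {p : ℝ} (hp : 1 < p) (hdθ : 1 < (d : ℝ) * θ) (hθ0 : 0 < θ) (hθ1 : θ < 1)
    (hdp : (d : ℝ) * θ = (d : ℝ) ^ (1 / p)) (hF : ∀ s t, 0 ≤ F s t)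
    (hmono : ∀ s t s' t', s ≤ s' → t' ≤ t → F s' t' ≤ F s t)
    (hsum : ∀ s : ℕ → ℕ, Monotone s →
      θ * ∑ l ∈ Finset.range d, F (s l) (s (l + 1)) ≤ F (s 0) (s d)) (n : ℕ) :
    1 / (2 * (d : ℝ)) * (∑ i ∈ Finset.range n, F i (i + 1) ^ p) ^ (1 / p) ≤ F 0 n := by
  classical
  have hp0 : 0 < p := by linarith
  have hd1 : (1 : ℝ) < d := by nlinarith [Nat.cast_nonneg (α := ℝ) d]
  have hd0 : (0 : ℝ) < d := by linarith
  set P : ℕ → ℝ := fun i => F i (i + 1) ^ p with hP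
  have hP0 : ∀ i, 0 ≤ P i := fun i => Real.rpow_nonneg (hF _ _) _
  set A := ∑ i ∈ Finset.range n, P i with hA
  have hA0 : 0 ≤ A := Finset.sum_nonneg fun i _ => hP0 i
  rcases hA0.eq_or_lt with h0 | hApos
  · rw [← h0, Real.zero_rpow (by positivity), mul_zero]
    exact hF _ _
  set S : ℕ → ℝ := fun i => ∑ i' ∈ Finset.range i, P i' with hS
  have hSm : Monotone S := monotone_nat_of_le_succ fun i => by
    simp only [hS, Finset.sum_range_succ]
    linarith [hP0 i]
  have hSs : ∀ i, S (i + 1) = S i + P i := fun i => Finset.sum_range_succ _ _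
  -- Midpoints of consecutive intervals of lengths $P_i$: any other midpoint is at distance at least
  -- $P_i/2$.
  set u : ℕ → ℝ := fun i => S i + P i / 2 with hu
  have hult : ∀ i i', i < i' → P i / 2 + P i' / 2 ≤ u i' - u i := fun i i' h => by
    have := hSm (Nat.succ_le_of_lt h)
    rw [Nat.succ_eq_add_one, hSs] at this
    simp only [hu]
    linarith
  have hum : Monotone u := fun i i' h => by
    rcases h.eq_or_lt with rfl | h
    · exact le_rfl
    · linarith [hult i i' h, hP0 i, hP0 i']
  have hsep : ∀ i i', i ≠ i' → P i / 2 ≤ |u i - u i'| := fun i i' h => by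
    rcases lt_or_gt_of_ne h with h | h
    · rw [abs_sub_comm]
      exact le_trans (by linarith [hult i i' h, hP0 i']) (le_abs_self _)
    · exact le_trans (by linarith [hult i' i h, hP0 i']) (le_abs_self _)
  have hex : ∀ i, ∃ m : ℕ, P i = 0 ∨ A ≤ (d : ℝ) ^ m * (P i / 2) := fun i => by
    rcases (hP0 i).eq_or_lt with h | h
    · exact ⟨0, Or.inl h.symm⟩
    · obtain ⟨m, hm⟩ := pow_unbounded_of_one_lt (A / (P i / 2)) hd1
      refine ⟨m, Or.inr ?_⟩
      rw [div_lt_iff₀ (by positivity)] at hm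
      exact hm.le
  set σ : ℕ → ℕ := fun i => Nat.find (hex i) with hσ
  have hFP : ∀ i, F i (i + 1) ≠ 0 → 0 < P i := fun i h =>
    Real.rpow_pos_of_pos (lt_of_le_of_ne (hF _ _) (Ne.symm h)) _
  have key := sum_pow_mul_le_cut (by exact_mod_cast hd0) hθ0.le hF hmono hsum n hum
    (fun i => P i / 2) hsep ((Finset.range n).sup σ) 0 A hA0 σ (by
      intro i hi hi0
      refine ⟨Finset.le_sup (f := σ) (Finset.mem_range.2 ((mem_Ico_cut hum).1 hi).1), ?_⟩
      exact (Nat.find_spec (hex i)).resolve_left (hFP i hi0).ne')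
  rw [zero_add] at key
  refine le_trans (le_trans ?_ key) (hmono _ _ _ _ (Nat.zero_le _) (cut_le n u A))
  have hsub : Finset.Ico (cut n u 0) (cut n u A) ⊆ Finset.range n := fun i hi =>
    Finset.mem_range.2 ((mem_Ico_cut hum).1 hi).1
  have hAI : A = ∑ i ∈ Finset.Ico (cut n u 0) (cut n u A), P i := by
    refine (Finset.sum_subset hsub fun i hi hi' => ?_).symm
    by_contra hne
    have hpos : 0 < P i := lt_of_le_of_ne (hP0 i) (Ne.symm hne)
    -- A midpoint of an interval of positive length lies strictly below $A$; only zero terms can be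
    -- lost.
    refine hi' ((mem_Ico_cut hum).2 ⟨Finset.mem_range.1 hi, ?_, ?_⟩)
    · exact add_nonneg (Finset.sum_nonneg fun i _ => hP0 i) (by linarith)
    · have := hSm (Nat.succ_le_of_lt (Finset.mem_range.1 hi))
      rw [Nat.succ_eq_add_one, hSs] at this
      have hSn : S n = A := rfl
      simp only [hu]
      linarith
  -- With this exponent $\theta=d^{-r}$, so a bound on $d^{-\sigma_i}$ becomes one on
  -- $\theta^{\sigma_i}$.
  set r : ℝ := 1 - 1 / p with hr
  have hr1 : 1 / p < 1 := by rw [div_lt_one hp0]; exact hp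
  have hr0 : 0 < r := by linarith
  have hrle : r ≤ 1 := by
    have : 0 < 1 / p := by positivity
    linarith
  have hθr : θ = (1 / (d : ℝ)) ^ r := by
    rw [one_div, Real.inv_rpow hd0.le, hr, Real.rpow_sub hd0, Real.rpow_one, ← hdp]
    field_simp
  have term : ∀ i ∈ Finset.Ico (cut n u 0) (cut n u A),
      P i * (1 / (2 * d * A) ^ r) ≤ θ ^ σ i * F i (i + 1) := by
    intro i hi
    rcases (hP0 i).eq_or_lt with h | hpos
    · rw [← h, zero_mul]
      exact mul_nonneg (by positivity) (hF _ _)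
    have hPA : P i ≤ A := Finset.single_le_sum (fun i _ => hP0 i) (hsub hi)
    have hσ0 : σ i ≠ 0 := by
      intro h
      have h2 := (Nat.find_spec (hex i)).resolve_left hpos.ne'
      change A ≤ (d : ℝ) ^ σ i * _ at h2
      rw [h, pow_zero, one_mul] at h2
      linarith
    obtain ⟨τ, hτ⟩ := Nat.exists_eq_succ_of_ne_zero hσ0
    -- One division fewer does not isolate: $d^{\sigma_i-1}P_i/2<A$. This gives $d^{-\sigma_i}\ge
    -- P_i/(2dA)$, the source of the constant $2d$.
    have hmin := Nat.find_min (hex i) (m := τ) (by change τ < σ i; omega)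
    push Not at hmin
    have h1 : P i / (2 * d * A) ≤ (1 / (d : ℝ)) ^ σ i := by
      rw [hτ, Nat.succ_eq_add_one, one_div_pow, pow_succ, div_le_div_iff₀ (by positivity)
        (by positivity)]
      have := hmin.2
      nlinarith
    have h2 : (P i / (2 * d * A)) ^ r ≤ θ ^ σ i := by
      rw [hθr, ← Real.rpow_natCast, ← Real.rpow_mul (by positivity), mul_comm r,
        Real.rpow_mul (by positivity), Real.rpow_natCast]
      exact Real.rpow_le_rpow (by positivity) h1 hr0.le
    have h3 : F i (i + 1) = P i ^ (1 / p) := by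
      rw [hP, ← Real.rpow_mul (hF _ _), mul_one_div_cancel hp0.ne', Real.rpow_one]
    have h4 : P i = P i ^ r * P i ^ (1 / p) := by
      rw [← Real.rpow_add hpos, hr, sub_add_cancel, Real.rpow_one]
    calc P i * (1 / (2 * d * A) ^ r) = (P i / (2 * d * A)) ^ r * P i ^ (1 / p) := by
          rw [Real.div_rpow hpos.le (by positivity)]
          conv_lhs => rw [h4]
          ring
      _ ≤ θ ^ σ i * P i ^ (1 / p) :=
          mul_le_mul_of_nonneg_right h2 (Real.rpow_nonneg hpos.le _)
      _ = _ := by rw [h3]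
  refine le_trans ?_ (Finset.sum_le_sum term)
  rw [← Finset.sum_mul, ← hAI]
  -- The argument yields the constant $(2d)^{-r}$, which is weakened to $1/(2d)$.
  have h5 : (2 * (d : ℝ)) ^ r ≤ 2 * d := by
    have := Real.rpow_le_rpow_of_exponent_le (x := 2 * (d : ℝ)) (by linarith) hrle
    rwa [Real.rpow_one] at this
  have h6 : A = A ^ r * A ^ (1 / p) := by
    rw [← Real.rpow_add hApos, hr, sub_add_cancel, Real.rpow_one]
  have hAr : 0 < A ^ r := Real.rpow_pos_of_pos hApos _
  have h2d : 0 < (2 * (d : ℝ)) ^ r := Real.rpow_pos_of_pos (by positivity) _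
  have h7 : A * (1 / (2 * d * A) ^ r) = 1 / (2 * (d : ℝ)) ^ r * A ^ (1 / p) := by
    rw [Real.mul_rpow (by positivity) hA0, mul_one_div, div_mul_eq_mul_div, one_mul,
      div_eq_div_iff (by positivity) h2d.ne']
    linear_combination (2 * (d : ℝ)) ^ r * h6
  rw [h7]
  exact mul_le_mul_of_nonneg_right (one_div_le_one_div_of_le h2d h5) (Real.rpow_nonneg hA0 _)

end

/-! ### Passage to the completion and comparison with $\ell_p$ -/

theorem incl_zero {k d : ℕ} {θ : Set.Ioo (0 : ℝ) 1} : incl d θ (0 : Ome k →₀ ℝ) = 0 :=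
  UniformSpace.Completion.coe_zero

theorem incl_sum_smul {k d : ℕ} {θ : Set.Ioo (0 : ℝ) 1} {ι : Type*} (I : Finset ι) (a : ι → ℝ)
    (x : ι → Ome k →₀ ℝ) :
    ∑ i ∈ I, a i • incl d θ (x i) = incl d θ (∑ i ∈ I, a i • x i) := by
  classical
  have hadd : ∀ y z : Ome k →₀ ℝ, incl d θ (y + z) = incl d θ y + incl d θ z :=
    fun y z => UniformSpace.Completion.coe_add (α := PreT k d θ) y z
  have hsmul : ∀ (c : ℝ) (y : Ome k →₀ ℝ), incl d θ (c • y) = c • incl d θ y :=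
    fun c y => UniformSpace.Completion.coe_smul (X := PreT k d θ) c y
  induction I using Finset.induction_on with
  | empty => simp [incl_zero]
  | insert i I hi ih => rw [Finset.sum_insert hi, Finset.sum_insert hi, hadd, hsmul, ih]

/-- Sequences in complete spaces whose finite linear combinations have comparable norms are
equivalent. -/
theorem equivalentSeq_of_norm_le {E F : Type} [NormedAddCommGroup E] [NormedSpace ℝ E]
    [CompleteSpace E] [NormedAddCommGroup F] [NormedSpace ℝ F] [CompleteSpace F]
    {x : ℕ → E} {y : ℕ → F} {c C : ℝ} (hc : 0 < c)
    (h₁ : ∀ (n : ℕ) (a : ℕ → ℝ),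
      c * ‖∑ i ∈ Finset.range n, a i • y i‖ ≤ ‖∑ i ∈ Finset.range n, a i • x i‖)
    (h₂ : ∀ (n : ℕ) (a : ℕ → ℝ),
      ‖∑ i ∈ Finset.range n, a i • x i‖ ≤ C * ‖∑ i ∈ Finset.range n, a i • y i‖) :
    EquivalentSeq x y := by
  have aux : ∀ {G H : Type} [NormedAddCommGroup G] [NormedSpace ℝ G] [CompleteSpace G]
      [NormedAddCommGroup H] [NormedSpace ℝ H] (z : ℕ → G) (w : ℕ → H) (K : ℝ),
      (∀ (n : ℕ) (a : ℕ → ℝ),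
        ‖∑ i ∈ Finset.range n, a i • z i‖ ≤ K * ‖∑ i ∈ Finset.range n, a i • w i‖) →
      ∀ a : ℕ → ℝ, (∃ l, Tendsto (fun n => ∑ i ∈ Finset.range n, a i • w i) atTop (𝓝 l)) →
        ∃ l, Tendsto (fun n => ∑ i ∈ Finset.range n, a i • z i) atTop (𝓝 l) := by
    intro G H _ _ _ _ _ z w K h a ⟨l, hl⟩
    have hdiff : ∀ {V : Type} [NormedAddCommGroup V] [NormedSpace ℝ V] (f : ℕ → V) (m n : ℕ),
        m ≤ n → ∑ i ∈ Finset.range n, (if m ≤ i then a i else 0) • f i =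
          ∑ i ∈ Finset.range n, a i • f i - ∑ i ∈ Finset.range m, a i • f i := by
      intro V _ _ f m n hmn
      rw [← Finset.sum_Ico_eq_sub _ hmn]
      simp only [ite_smul, zero_smul]
      rw [← Finset.sum_filter]
      refine Finset.sum_congr ?_ fun _ _ => rfl
      ext i
      simp only [Finset.mem_filter, Finset.mem_range, Finset.mem_Ico]
      exact and_comm
    refine cauchySeq_tendsto_of_complete (Metric.cauchySeq_iff'.2 fun ε hε => ?_)
    obtain ⟨N, hN⟩ := Metric.cauchySeq_iff'.1 hl.cauchySeq (ε / (|K| + 1)) (by positivity)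
    refine ⟨N, fun n hn => ?_⟩
    have h0 := hN n hn
    rw [dist_eq_norm] at h0 ⊢
    -- Zeroing the coefficients below $N$ applies the norm inequality to differences of partial
    -- sums, so the Cauchy property transfers.
    have h3 := h n fun i => if N ≤ i then a i else 0
    rw [hdiff z N n hn, hdiff w N n hn] at h3
    rw [lt_div_iff₀ (by positivity)] at h0
    refine lt_of_le_of_lt h3 (lt_of_le_of_lt ?_ h0)
    rw [mul_comm]
    exact mul_le_mul_of_nonneg_left (by linarith [le_abs_self K]) (norm_nonneg _)
  refine fun a => ⟨aux y x c⁻¹ (fun n a => ?_) a, aux x y C h₂ a⟩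
  rw [← div_eq_inv_mul, le_div_iff₀' hc]
  exact h₁ n a

theorem norm_sum_smul_lp_single {p : ℝ} (hp : 1 < p) [Fact (1 ≤ ENNReal.ofReal p)] (n : ℕ)
    (a : ℕ → ℝ) :
    ‖∑ i ∈ Finset.range n, a i • (lp.single (ENNReal.ofReal p) i (1 : ℝ) :
        lp (fun _ : ℕ => ℝ) (ENNReal.ofReal p))‖ =
      (∑ i ∈ Finset.range n, |a i| ^ p) ^ (1 / p) := by
  have hp0 : 0 < p := by linarith
  have hpt : (ENNReal.ofReal p).toReal = p := ENNReal.toReal_ofReal hp0.le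
  have h := lp.norm_sum_single (E := fun _ : ℕ => ℝ) (p := ENNReal.ofReal p) (by rwa [hpt]) a
    (Finset.range n)
  rw [hpt] at h
  have hs : ∀ i, a i • (lp.single (ENNReal.ofReal p) i (1 : ℝ) :
      lp (fun _ : ℕ => ℝ) (ENNReal.ofReal p)) = lp.single (ENNReal.ofReal p) i (a i) := fun i => by
    rw [← lp.single_smul, smul_eq_mul, mul_one]
  simp only [hs]
  simp only [Real.norm_eq_abs] at h
  rw [← h, ← Real.rpow_mul (norm_nonneg _), mul_one_div_cancel hp0.ne', Real.rpow_one]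

theorem norm_sum_range_le {k d : ℕ} {θ : Set.Ioo (0 : ℝ) 1} {p : ℝ} (hp : 1 < p)
    (hdp : (d : ℝ) * (θ : ℝ) = (d : ℝ) ^ (1 / p)) (hd : 0 < d) {x : ℕ → Ome k →₀ ℝ} (n : ℕ)
    (hx : ∀ i < n, ‖incl d θ (x i)‖ = 1)
    (hs : ∀ i < n, ∀ j < n, i < j → Successive (x i).support (x j).support) (a : ℕ → ℝ) :
    ‖∑ i ∈ Finset.range n, a i • incl d θ (x i)‖ ≤
      2 / (θ : ℝ) * (∑ i ∈ Finset.range n, |a i| ^ p) ^ (1 / p) := by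
  rw [incl_sum_smul, norm_incl]
  refine (tNorm_sum_le hp hdp hd _ (fun i => a i • x i) fun i hi j hj hij e he f hf =>
    hs i (Finset.mem_range.1 hi) j (Finset.mem_range.1 hj) hij e (Finsupp.support_smul he) f
      (Finsupp.support_smul hf)).trans_eq ?_
  congr 2
  refine Finset.sum_congr rfl fun i hi => ?_
  rw [tNorm_smul, ← norm_incl, hx i (Finset.mem_range.1 hi), mul_one]

end EllentuckSpace

theorem mainTheorem2 (k d : ℕ) (hk : 2 ≤ k) (θ : Set.Ioo (0 : ℝ) 1)
    (hdθ : 1 < (d : ℝ) * (θ : ℝ)) (p : ℝ) (hp : 1 < p) [Fact (1 ≤ ENNReal.ofReal p)]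
    (hdp : (d : ℝ) * (θ : ℝ) = (d : ℝ) ^ (1 / p)) :
    (∀ (N : ℕ) (x : Fin N → Ome k →₀ ℝ), IsNormalizedBlock d θ x →
      ∀ a : Fin N → ℝ,
        ‖∑ j, a j • incl d θ (x j)‖ ≤ 2 / (θ : ℝ) * (∑ j, |a j| ^ p) ^ (1 / p)) ∧
    (∀ (x : ℕ → Ome k →₀ ℝ) (v : ℕ → Ome k), IsNormalizedBlock d θ x →
      (∀ i, ∀ w ∈ (x i).support, PrecEq (v i).1 w.1 ∧ Prec w.1 (v (i + 1)).1) →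
      (∀ i, ∀ w ∈ (x i).support, w ∈ Xmax (v i)) →
      (∀ i, v (i + 1) ∈ Xmax (v i)) →
        (∀ (n : ℕ) (a : ℕ → ℝ),
          1 / (2 * (d : ℝ)) * (∑ i ∈ Finset.range n, |a i| ^ p) ^ (1 / p) ≤
            ‖∑ i ∈ Finset.range n, a i • incl d θ (x i)‖) ∧
        EquivalentSeq (fun i => incl d θ (x i))
          (fun i => (lp.single (ENNReal.ofReal p) i (1 : ℝ) :
            lp (fun _ : ℕ => ℝ) (ENNReal.ofReal p)))) := by
  have hd : 0 < d := by
    rcases Nat.eq_zero_or_pos d with rfl | h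
    · norm_num at hdθ
    · exact h
  refine ⟨fun N x hx a => ?_, fun x v hx hxv hX hv => ?_⟩
  -- The finite sequence is extended by zero vectors, which are not normalized; hence
  -- `norm_sum_range_le` asks for its conditions only below $n$.
  · have h := norm_sum_range_le hp hdp hd (x := fun i => if h : i < N then x ⟨i, h⟩ else 0) N
      (fun i hi => by simpa [hi] using hx.1 ⟨i, hi⟩)
      (fun i hi j hj hij => by simpa only [hi, hj, dif_pos] using hx.2 ⟨i, hi⟩ ⟨j, hj⟩ hij)
      (fun i => if h : i < N then a ⟨i, h⟩ else 0)
    simpa [Finset.sum_range] using h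
  · have lower : ∀ (n : ℕ) (a : ℕ → ℝ),
        1 / (2 * (d : ℝ)) * (∑ i ∈ Finset.range n, |a i| ^ p) ^ (1 / p) ≤
          ‖∑ i ∈ Finset.range n, a i • incl d θ (x i)‖ := by
      intro n a
      have hx0 : ∀ i, x i ≠ 0 := fun i h => by
        have := hx.1 i
        rw [h, incl_zero, norm_zero] at this
        exact zero_ne_one this
      have h := lower_estimate (F := blockNorm d θ x a) hp hdθ θ.2.1 θ.2.2 hdp
        (fun s t => tNorm_nonneg d θ _)
        (fun s t s' t' hs ht => blockNorm_mono hxv hX hv a hs ht)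
        (sum_blockNorm_le hx0 hxv hX hv a) n
      have h1 : ∀ i, blockNorm d θ x a i (i + 1) = |a i| := fun i => by
        rw [blockNorm, Nat.Ico_succ_singleton, Finset.sum_singleton, tNorm_smul, ← norm_incl,
          hx.1, mul_one]
      simp only [h1] at h
      rw [incl_sum_smul, norm_incl, Finset.range_eq_Ico]
      rw [Finset.range_eq_Ico] at h
      exact h
    refine ⟨lower, equivalentSeq_of_norm_le (c := 1 / (2 * (d : ℝ))) (C := 2 / (θ : ℝ))
      (by positivity) (fun n a => ?_) fun n a => ?_⟩
    · rw [norm_sum_smul_lp_single hp]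
      exact lower n a
    · rw [norm_sum_smul_lp_single hp]
      exact norm_sum_range_le hp hdp hd n (fun i _ => hx.1 i) (fun i _ j _ h => hx.2 i j h) a
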